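/- **Conventions.** A vocabulary is a finite set of relation symbols, each with an arity. For a vocabulary $\sigma$, a $\sigma$-structure consists of a universe (a set) and an $r$-ary relation $R(A)$ on it for each symbol $R\in\sigma$ of arity $r$; homomorphisms are maps of universes that preserve all relations, and $B\to A$ means that a homomorphism from $B$ to $A$ exists. For a fixed $\sigma$-structure $A$, $\mathrm{CSP}(A)$ is the problem: given a finite non-empty $\sigma$-structure $B$, decide whether $B\to A$. The input $B$ has universe $\{0,\dots,n-1\}$, $n\ge 1$, and is written as a word over a finite alphabet: $n$ in unary, followed by a list, in any order, of the tuples in the relations of $B$ (each tuple is given by its relation symbol followed by its entries in unary). We say that $A$ *has polynomial CSP* if some (multi-stack) Turing machine decides $\mathrm{CSP}(A)$ in a number of steps bounded by a polynomial in the length of the input word. Let $\sigma,\tau$ be vocabularies. A *pattern* consists of a finite non-empty $\sigma$-structure $P$ and, for every $R\in\tau$ of arity $r$, a finite non-empty $\sigma$-structure $Q_R$ with $r$ fixed homomorphisms $q_{R,1},\dots,q_{R,r}:P\to Q_R$. It defines, for every $\sigma$-structure $A$, a $\tau$-structure $\Psi A$: its universe is the (possibly empty) set of all homomorphisms $f:P\to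 A$, and for $R\in\tau$ of arity $r$, $(f_1,\dots,f_r)\in R(\Psi A)$ if and only if there is a homomorphism $g:Q_R\to A$ with $g\circ q_{R,i}=f_i$ for $i=1,\dots,r$. **Corollary 4.2.** Let $\sigma,\tau$ be vocabularies, let $\Psi$ be given by a pattern as above, and let $A$ be a $\sigma$-structure with non-empty (finite or infinite) universe. If $A$ has polynomial CSP, then $\Psi A$ has polynomial CSP. -/

import Mathlib

universe u v

namespace RelCSP

open scoped FirstOrder

/-- A pattern from `σ`-structures to `τ`-structures: a `σ`-structure `P` and, for every relation
symbol `R` of `τ` of arity `r`, a `σ`-structure `Q R` with `r` fixed homomorphisms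
`q R i : P → Q R`. All these structures are finite and non-empty. -/
structure Pattern (σ τ : FirstOrder.Language.{0, 0}) where
  P : Type v
  [strP : σ.Structure P]
  [finiteP : Finite P]
  [nonemptyP : Nonempty P]
  Q : ∀ {r : ℕ}, τ.Relations r → Type v
  [strQ : ∀ {r : ℕ} (R : τ.Relations r), σ.Structure (Q R)]
  [finiteQ : ∀ {r : ℕ} (R : τ.Relations r), Finite (Q R)]
  [nonemptyQ : ∀ {r : ℕ} (R : τ.Relations r), Nonempty (Q R)]
  q : ∀ {r : ℕ} (R : τ.Relations r), Fin r → (P →[σ] Q R)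

attribute [instance] Pattern.strP Pattern.finiteP Pattern.nonemptyP
attribute [instance] Pattern.strQ Pattern.finiteQ Pattern.nonemptyQ

/-- The universe of `Ψ A`: the set of all homomorphisms `P → A`. -/
def Pattern.Psi {σ τ : FirstOrder.Language.{0, 0}} (Ψ : Pattern.{v} σ τ) (A : Type u) [σ.Structure A] :
    Type (max u v) :=
  Ψ.P →[σ] A

/-- The relations of `Ψ A`: `(f₁, …, f_r) ∈ R(Ψ A)` iff there is a homomorphism `g : Q R → A`
with `g ∘ q R i = f_i` for all `i`. -/
instance Pattern.structurePsi {σ τ : FirstOrder.Language.{0, 0}} [τ.IsRelational] (Ψ : Pattern.{v} σ τ)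
    (A : Type u) [σ.Structure A] : τ.Structure (Ψ.Psi A) where
  funMap := fun f _ => isEmptyElim f
  RelMap := fun {_} R f => ∃ g : Ψ.Q R →[σ] A, ∀ i, g.comp (Ψ.q R i) = f i

/-- An input of a constraint satisfaction problem over the vocabulary `τ`: a finite non-empty
`τ`-structure with universe `{0, …, size - 1}`, its relations given by the list of the tuples
`R(x₁, …, x_r)` that hold. -/
structure Input (τ : FirstOrder.Language.{0, 0}) where
  size : ℕ
  size_pos : 0 < size
  facts : List (Σ r : ℕ, τ.Relations r × (Fin r → Fin size))

def Input.Universe {τ : FirstOrder.Language.{0, 0}} (B : Input τ) : Type :=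
  Fin B.size

instance Input.structureUniverse {τ : FirstOrder.Language.{0, 0}} [τ.IsRelational] (B : Input τ) :
    τ.Structure B.Universe where
  funMap := fun f _ => isEmptyElim f
  RelMap := fun {r} R x => (⟨r, R, x⟩ : Σ r : ℕ, τ.Relations r × (Fin r → Fin B.size)) ∈ B.facts

/-- The alphabet in which inputs are written; it is finite when the vocabulary is finite. -/
inductive Letter (τ : FirstOrder.Language.{0, 0}) : Type
  | rel {r : ℕ} (R : τ.Relations r) : Letter τ
  | tick : Letter τ
  | mark : Letter τ

/-- A natural number in unary, followed by an end marker. -/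
def encodeNat (τ : FirstOrder.Language.{0, 0}) (n : ℕ) : List (Letter τ) :=
  List.replicate n Letter.tick ++ [Letter.mark]

/-- The word of an input: the size of the universe, then for each listed tuple its relation
symbol followed by its entries. -/
def Input.encode {τ : FirstOrder.Language.{0, 0}} (B : Input τ) : List (Letter τ) :=
  encodeNat τ B.size ++
    B.facts.flatMap fun F =>
      Letter.rel F.2.1 :: (List.ofFn F.2.2).flatMap fun x : Fin B.size => encodeNat τ (x : ℕ)

open Classical in
/-- The constraint satisfaction problem with template `A`: does the input admit a homomorphism
to `A`? -/
noncomputable def csp {τ : FirstOrder.Language.{0, 0}} [τ.IsRelational] (A : Type u) [τ.Structure A]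
    (B : Input τ) : Bool :=
  decide (Nonempty (B.Universe →[τ] A))

/-- `A` has polynomial CSP: some Turing machine (multi-stack, with finite control) decides the
constraint satisfaction problem with template `A` in a number of steps bounded by a polynomial
in the length of the input word. -/
def PolynomialCSP (τ : FirstOrder.Language.{0, 0}) [τ.IsRelational] (A : Type u) [τ.Structure A] : Prop :=
  Nonempty (Turing.TM2ComputableInPolyTime (Input.encode (τ := τ)) Computability.encodeBool
    (csp A))

end RelCSP

/-! The construction `Ψ` has a left adjoint on finite structures. Given `B`, take one copy of `P`
for every element of `B` and one copy of `Q R` for every listed tuple `R(x₁, …, x_r)`, and glue `q R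
i p` in that copy to `p` in the copy of `P` at `x_i`. A homomorphism from the glued structure to `A`
is a family of homomorphisms `P → A`, one for each element of `B`, such that every listed tuple has
a witness `Q R → A`: exactly a homomorphism `B → Ψ A`. This is `exists_sat_iff`. So gluing reduces
the problem for `Ψ A` to the problem for `A`; as the pattern is fixed, the glued structure has
polynomial size.

No quotient is formed. The elements of all copies are consecutive numbers, and each identification
is an equation between two numbers, eliminated by substituting one number for the other in the facts
and in the remaining equations. A number that has been substituted away stays in the universe
without facts and puts no constraint on homomorphisms. `exists_sat_elimFacts` shows that solvability
in `A` is unchanged.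

The rest is to carry this out on a multi-stack machine in polynomial time. Structured programs on
stacks have a big-step semantics with time bounds (`Runs`), and `Runs.steps` compiles them to
machine code. `go_translate` shows that one such program writes the glued input,
`exists_polynomial_runs` bounds its time by a polynomial, and `computableInPolyTime_comp` runs the
given machine on its output. The semantic side and the word side meet in `toToks_elimFacts` and
`encode_inputOf`. -/

/-! ### A structured language for multi-stack machines -/

namespace StackProg

set_option linter.unusedSectionVars false

open Turing Function

variable {K : Type} [DecidableEq K] {Γ : K → Type}

/-- Structured programs acting on a family of stacks. -/
inductive Prog (Γ : K → Type) : Type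
  | skip : Prog Γ
  | push (k : K) (a : Γ k) : Prog Γ
  | pop (k : K) : Prog Γ
  | peek (k : K) (f : Option (Γ k) → Prog Γ) : Prog Γ
  | seq (p q : Prog Γ) : Prog Γ
  | loop (k : K) (c : Option (Γ k) → Bool) (p : Prog Γ) : Prog Γ

/-- `Runs p S S' t`: started on the stacks `S`, the program `p` halts with the stacks `S'` after
at most `t` steps. -/
inductive Runs : Prog Γ → (∀ k, List (Γ k)) → (∀ k, List (Γ k)) → ℕ → Prop
  | skip (S) : Runs .skip S S 1
  | push (k a S) : Runs (.push k a) S (update S k (a :: S k)) 1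
  | pop (k S) : Runs (.pop k) S (update S k (S k).tail) 1
  | peek {k f S S' t} : Runs (f (S k).head?) S S' t → Runs (.peek k f) S S' (t + 1)
  | seq {p q S S' S'' t t'} : Runs p S S' t → Runs q S' S'' t' → Runs (.seq p q) S S'' (t + t')
  | loop_done {k c p S} : c (S k).head? = false → Runs (.loop k c p) S S 1
  | loop_step {k c p S S' S'' t t'} : c (S k).head? = true → Runs p S S' t →
      Runs (.loop k c p) S' S'' t' → Runs (.loop k c p) S S'' (t + t' + 1)
  | mono {p S S' t t'} : Runs p S S' t → t ≤ t' → Runs p S S' t'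

/-- A step pushes at most one symbol. The running time therefore also bounds the length of the
output, which is what the next machine's time is measured in. -/
theorem Runs.length_le {p : Prog Γ} {S S' : ∀ k, List (Γ k)} {t : ℕ} (h : Runs p S S' t) (k : K) :
    (S' k).length ≤ (S k).length + t := by
  induction h with
  | skip S => omega
  | push k' a S =>
    rcases eq_or_ne k k' with rfl | hk
    · simp
    · simp [update_of_ne hk]
  | pop k' S =>
    rcases eq_or_ne k k' with rfl | hk
    · simp only [update_self, List.length_tail]; omega
    · simp [update_of_ne hk]
  | peek _ ih => omega
  | seq _ _ ih ih' => omega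
  | loop_done _ => omega
  | loop_step _ _ _ ih ih' => omega
  | mono _ hle ih => omega

/-! ### Compilation of structured programs to machine code -/

/-- The program points of a program. -/
def Lab : Prog Γ → Type
  | .skip => Unit
  | .push _ _ => Unit
  | .pop _ => Unit
  | .peek _ f => Option (Sigma fun o => Lab (f o))
  | .seq p q => Lab p ⊕ Lab q
  | .loop _ _ p => Option (Lab p)

theorem finite_lab [∀ k, Finite (Γ k)] (p : Prog Γ) : Finite (Lab p) := by
  induction p with
  | skip => exact inferInstanceAs (Finite Unit)
  | push k a => exact inferInstanceAs (Finite Unit)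
  | pop k => exact inferInstanceAs (Finite Unit)
  | peek k f ih => exact inferInstanceAs (Finite (Option (Σ o, Lab (f o))))
  | seq p q ihp ihq => exact inferInstanceAs (Finite (Lab p ⊕ Lab q))
  | loop k c p ih => exact inferInstanceAs (Finite (Option (Lab p)))

/-- The point at which a program is entered. -/
def entry : (p : Prog Γ) → Lab p
  | .skip => ()
  | .push _ _ => ()
  | .pop _ => ()
  | .peek _ _ => (none : Option (Sigma fun _ => Lab _))
  | .seq p _ => Sum.inl (entry p)
  | .loop _ _ p => (none : Option (Lab p))

/-- The contents of the register that holds the last symbol read, when read from the stack `k`. -/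
def regGet (k : K) : Option (Σ k, Γ k) → Option (Γ k)
  | some x => if h : x.1 = k then some (h ▸ x.2) else none
  | none => none

@[simp]
theorem regGet_map (k : K) (o : Option (Γ k)) : regGet k (o.map (Sigma.mk k)) = o := by
  cases o <;> simp [regGet]

variable {K₁ : Type} [DecidableEq K₁] {Γ₁ : K₁ → Type}

/-- The alphabets of the union of two families of stacks. -/
@[reducible]
def CombΓ (Γ₁ : K₁ → Type) (Γ : K → Type) : K₁ ⊕ K → Type
  | .inl k => Γ₁ k
  | .inr k => Γ k

/-- The union of two families of stacks. -/
def comb (T : ∀ k, List (Γ₁ k)) (S : ∀ k, List (Γ k)) : ∀ k, List (CombΓ Γ₁ Γ k)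
  | .inl k => T k
  | .inr k => S k

@[simp] theorem comb_inl (T : ∀ k, List (Γ₁ k)) (S : ∀ k, List (Γ k)) (k : K₁) :
    comb T S (.inl k) = T k := rfl

@[simp] theorem comb_inr (T : ∀ k, List (Γ₁ k)) (S : ∀ k, List (Γ k)) (k : K) :
    comb T S (.inr k) = S k := rfl

theorem update_comb_inr (T : ∀ k, List (Γ₁ k)) (S : ∀ k, List (Γ k)) (k : K) (l : List (Γ k)) :
    update (comb T S) (.inr k) l = comb T (update S k l) := by
  funext x
  rcases x with x | x
  · rw [update_of_ne (by simp)]; rfl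
  · rcases eq_or_ne x k with rfl | h
    · simp
    · rw [update_of_ne (by simpa using h)]; simp [update_of_ne h]

theorem update_comb_inl (T : ∀ k, List (Γ₁ k)) (S : ∀ k, List (Γ k)) (k : K₁) (l : List (Γ₁ k)) :
    update (comb T S) (.inl k) l = comb (update T k l) S := by
  funext x
  rcases x with x | x
  · rcases eq_or_ne x k with rfl | h
    · simp
    · rw [update_of_ne (by simpa using h)]; simp [update_of_ne h]
  · rw [update_of_ne (by simp)]; rfl

variable {Λ s : Type}

open TM2.Stmt in
/-- The code of a program, its points embedded into the labels by `emb`; it leaves at the label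
`exit`. -/
def code : (p : Prog Γ) → (Lab p → Λ) → Λ → Lab p →
    TM2.Stmt (CombΓ Γ₁ Γ) Λ (s × Option (Σ k, Γ k))
  | .skip, _, exit => fun _ => goto fun _ => exit
  | .push k a, _, exit => fun _ => push (.inr k) (fun _ => a) (goto fun _ => exit)
  | .pop k, _, exit => fun _ => pop (.inr k) (fun v _ => v) (goto fun _ => exit)
  | .peek k f, emb, exit => fun l => match l with
    | none => peek (.inr k) (fun v a => (v.1, Option.map (Sigma.mk k) a))
        (goto fun v => emb (some ⟨regGet k v.2, entry (f (regGet k v.2))⟩))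
    | some ⟨o, l⟩ => code (f o) (fun l => emb (some ⟨o, l⟩)) exit l
  | .seq p q, emb, exit =>
      Sum.rec (code p (fun l => emb (Sum.inl l)) (emb (Sum.inr (entry q))))
        (code q (fun l => emb (Sum.inr l)) exit)
  | .loop k c p, emb, exit => fun l => match l with
    | none => peek (.inr k) (fun v a => (v.1, Option.map (Sigma.mk k) a))
        (goto fun v => bif c (regGet k v.2) then emb (some (entry p)) else exit)
    | some l => code p (fun l => emb (some l)) (emb none) l

/-- `n` steps of a partial function lead from `c` to `c'`. -/
def Steps {C : Type*} (f : C → Option C) (n : ℕ) (c c' : C) : Prop :=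
  (flip bind f)^[n] (some c) = some c'

theorem Steps.trans {C : Type*} {f : C → Option C} {m n : ℕ} {a b c : C} (h : Steps f m a b)
    (h' : Steps f n b c) : Steps f (n + m) a c := by
  unfold Steps at *
  rw [iterate_add_apply, h, h']

theorem Steps.one {C : Type*} {f : C → Option C} {a b : C} (h : f a = some b) : Steps f 1 a b := h

/-- A map that commutes with one step commutes with all iterates. This carries runs of a machine
over to a larger machine containing it. -/
theorem Steps.map {C D : Type*} {f : C → Option C} {g : D → Option D} (φ : C → D)
    (h : ∀ c, g (φ c) = (f c).map φ) {n : ℕ} {a b : C} (hs : Steps f n a b) :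
    Steps g n (φ a) (φ b) := by
  have key : ∀ o : Option C, (flip bind g)^[n] (o.map φ) = ((flip bind f)^[n] o).map φ := by
    intro o
    refine (Function.Semiconj.iterate_right (f := Option.map φ) (fun o => ?_) n o).symm
    cases o with
    | none => rfl
    | some c => exact (h c).symm
  unfold Steps at *
  have := key (some a)
  rw [hs] at this
  simpa using this

theorem step_code {p : Prog Γ}
    (M : Λ → TM2.Stmt (CombΓ Γ₁ Γ) Λ (s × Option (Σ k, Γ k))) (emb : Lab p → Λ) (exit : Λ)
    (hM : ∀ l, M (emb l) = code p emb exit l) (l : Lab p) (v : s × Option (Σ k, Γ k))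
    (S : ∀ k, List (CombΓ Γ₁ Γ k)) :
    TM2.step M ⟨some (emb l), v, S⟩ = some (TM2.stepAux (code p emb exit l) v S) := by
  rw [← hM]; rfl

/-- Correctness of the compiler. The machine, the embedding of program points and the exit label are
arbitrary, so the induction can place a subprogram inside the code of a larger one. The register
ends with whatever was tested last, hence the existential; the state `x` and the stacks `T` of the
other machine are untouched. -/
theorem Runs.steps {p : Prog Γ} {S S' : ∀ k, List (Γ k)} {t : ℕ} (h : Runs p S S' t)
    (M : Λ → TM2.Stmt (CombΓ Γ₁ Γ) Λ (s × Option (Σ k, Γ k))) (emb : Lab p → Λ) (exit : Λ)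
    (hM : ∀ l, M (emb l) = code p emb exit l) (x : s) (r : Option (Σ k, Γ k))
    (T : ∀ k, List (Γ₁ k)) :
    ∃ n ≤ t, ∃ r', Steps (TM2.step M) n ⟨some (emb (entry p)), (x, r), comb T S⟩
      ⟨some exit, (x, r'), comb T S'⟩ := by
  induction h generalizing exit r with
  | skip S => exact ⟨1, le_rfl, r, Steps.one (step_code M emb exit hM _ _ _)⟩
  | push k a S =>
    refine ⟨1, le_rfl, r, Steps.one ((step_code M emb exit hM _ _ _).trans ?_)⟩
    simp [code, update_comb_inr]
  | pop k S =>
    refine ⟨1, le_rfl, r, Steps.one ((step_code M emb exit hM _ _ _).trans ?_)⟩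
    simp [code, update_comb_inr]
  | @peek k f S S' t _ ih =>
    obtain ⟨n, hn, r', h⟩ := ih (fun l => emb (some ⟨_, l⟩)) exit
      (fun l => (hM (some ⟨_, l⟩)).trans (by simp only [code])) ((S k).head?.map (Sigma.mk k))
    refine ⟨n + 1, by omega, r',
      Steps.trans (Steps.one ((step_code M emb exit hM _ _ _).trans ?_)) h⟩
    -- The type of the inner point depends on the symbol read, so the equality is transported
    -- through the dependent pair.
    have key : ∀ o o', o = o' → emb (some ⟨o, entry (f o)⟩) = emb (some ⟨o', entry (f o')⟩) := by
      rintro _ _ rfl; rfl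
    simpa [code, entry] using key _ _ (regGet_map k _)
  | @seq p q S S' S'' t t' _ _ ih ih' =>
    obtain ⟨n, hn, r', h⟩ := ih (fun l => emb (Sum.inl l)) (emb (Sum.inr (entry q)))
      (fun l => hM (Sum.inl l)) r
    obtain ⟨n', hn', r'', h'⟩ := ih' (fun l => emb (Sum.inr l)) exit
      (fun l => hM (Sum.inr l)) r'
    exact ⟨n' + n, by omega, r'', h.trans h'⟩
  | @loop_done k c p S hc =>
    refine ⟨1, le_rfl, (S k).head?.map (Sigma.mk k),
      Steps.one ((step_code M emb exit hM _ _ _).trans ?_)⟩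
    simp [code, entry, hc]
  | @loop_step k c p S S' S'' t t' hc _ _ ih ih' =>
    obtain ⟨n, hn, r', h⟩ := ih (fun l => emb (some l)) (emb none)
      (fun l => hM (some l)) ((S k).head?.map (Sigma.mk k))
    obtain ⟨n', hn', r'', h'⟩ := ih' emb exit hM r'
    refine ⟨n' + (n + 1), by omega, r'',
      Steps.trans (Steps.trans (Steps.one ((step_code M emb exit hM _ _ _).trans ?_)) h) h'⟩
    simp [code, entry, hc]
  | mono _ hle ih =>
    obtain ⟨n, hn, r', h⟩ := ih emb exit hM r
    exact ⟨n, hn.trans hle, r', h⟩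

/-! ### Embedding a given machine into a larger one -/

open TM2.Stmt in
/-- A statement acting on the first family of stacks only. -/
def lift {Λ₁ : Type} (e : Λ₁ → Λ) : TM2.Stmt Γ₁ Λ₁ s →
    TM2.Stmt (CombΓ Γ₁ Γ) Λ (s × Option (Σ k, Γ k))
  | push k f q => push (.inl k) (fun v => f v.1) (lift e q)
  | peek k f q => peek (.inl k) (fun v o => (f v.1 o, v.2)) (lift e q)
  | pop k f q => pop (.inl k) (fun v o => (f v.1 o, v.2)) (lift e q)
  | load a q => load (fun v => (a v.1, v.2)) (lift e q)
  | branch c q₁ q₂ => branch (fun v => c v.1) (lift e q₁) (lift e q₂)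
  | goto l => goto fun v => e (l v.1)
  | halt => halt

/-- The corresponding embedding of configurations. -/
def liftCfg {Λ₁ : Type} (e : Λ₁ → Λ) (r : Option (Σ k, Γ k)) (S : ∀ k, List (Γ k))
    (c : TM2.Cfg Γ₁ Λ₁ s) : TM2.Cfg (CombΓ Γ₁ Γ) Λ (s × Option (Σ k, Γ k)) :=
  ⟨c.l.map e, (c.var, r), comb c.stk S⟩

theorem stepAux_lift {Λ₁ : Type} (e : Λ₁ → Λ) (r : Option (Σ k, Γ k)) (S : ∀ k, List (Γ k))
    (q : TM2.Stmt Γ₁ Λ₁ s) (v : s) (T : ∀ k, List (Γ₁ k)) :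
    TM2.stepAux (lift e q) (v, r) (comb T S) = liftCfg e r S (TM2.stepAux q v T) := by
  induction q generalizing v T with
  | push k f q ih => simp [lift, update_comb_inl, ih]
  | peek k f q ih => simp [lift, ih]
  | pop k f q ih => simp [lift, update_comb_inl, ih]
  | load a q ih => simp [lift, ih]
  | branch c q₁ q₂ ih₁ ih₂ => simp only [lift, TM2.stepAux, ih₁, ih₂]; cases c v <;> rfl
  | goto l => simp [lift, liftCfg]
  | halt => simp [lift, liftCfg]

/-- The family of stacks in which only the stack `k` may be non-empty. -/
def single (k : K) (l : List (Γ k)) : ∀ k, List (Γ k) :=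
  update (fun _ => []) k l

@[simp] theorem single_self (k : K) (l : List (Γ k)) : single k l k = l := update_self ..

theorem single_of_ne {k k' : K} (h : k' ≠ k) (l : List (Γ k)) : single k l k' = [] :=
  update_of_ne h ..

@[simp] theorem single_nil (k : K) : single (Γ := Γ) k [] = fun _ => [] := update_eq_self k _

theorem update_single (k : K) (l l' : List (Γ k)) : update (single k l) k l' = single k l' :=
  update_idem ..

theorem initList_stk (tm : FinTM2) (l : List (tm.Γ tm.k₀)) :
    (initList tm l).stk = single tm.k₀ l := by
  funext k
  by_cases h : k = tm.k₀
  · subst h; simp [initList]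
  · simp [initList, h, single]

theorem haltList_stk (tm : FinTM2) (l : List (tm.Γ tm.k₁)) :
    (haltList tm l).stk = single tm.k₁ l := by
  funext k
  by_cases h : k = tm.k₁
  · subst h; simp [haltList]
  · simp [haltList, h, single]

/-! ### Running a program and then a given machine -/

section Compose

variable (M : FinTM2) (kin kout : K) (cv : Option (Γ kout) → M.Γ M.k₀) (p : Prog Γ)

open TM2.Stmt in
/-- The code that runs a program, moves the contents of the stack `kout` to the input stack of
`M`, and runs `M`. -/
def composeCode : Lab p ⊕ Option M.Λ →
    TM2.Stmt (CombΓ M.Γ Γ) (Lab p ⊕ Option M.Λ) (M.σ × Option (Σ k, Γ k))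
  | .inl l => code p .inl (.inr none) l
  | .inr none => pop (.inr kout) (fun v a => (v.1, Option.map (Sigma.mk kout) a))
      (branch (fun v => v.2.isSome)
        (push (.inl M.k₀) (fun v => cv (regGet kout v.2)) (goto fun _ => .inr none))
        -- The register is cleared because a halting configuration must have the initial internal
        -- state; the lifted code never changes the register again.
        (load (fun v => (v.1, none)) (goto fun _ => .inr (some M.main))))
  | .inr (some l) => lift (fun l => .inr (some l)) (M.m l)

/-- Moving a stack symbol by symbol reverses it. This is why the program has to leave its output
reversed. -/
theorem steps_composeCode_move (x : M.σ) (w : List (Γ kout)) (r : Option (Σ k, Γ k))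
    (l : List (M.Γ M.k₀)) :
    Steps (TM2.step (composeCode M kout cv p)) (w.length + 1)
      ⟨some (.inr none), (x, r), comb (single M.k₀ l) (single kout w)⟩
      ⟨some (.inr (some M.main)), (x, none),
        comb (single M.k₀ ((w.map fun a => cv (some a)).reverse ++ l)) fun _ => []⟩ := by
  induction w generalizing r l with
  | nil =>
    refine Steps.one ?_
    simp [composeCode, update_comb_inr]
  | cons a w ih =>
    have h := ih (some ⟨kout, a⟩) (cv (some a) :: l)
    have h' : Steps (TM2.step (composeCode M kout cv p)) 1
        ⟨some (.inr none), (x, r), comb (single M.k₀ l) (single kout (a :: w))⟩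
        ⟨some (.inr none), (x, some ⟨kout, a⟩),
          comb (single M.k₀ (cv (some a) :: l)) (single kout w)⟩ := by
      refine Steps.one ?_
      have := regGet_map kout (some a)
      simp only [Option.map_some] at this
      simp [composeCode, update_comb_inr, update_comb_inl, update_single, this]
    simpa using h'.trans h

theorem steps_composeCode_lift {n : ℕ} {c c' : M.Cfg} (h : Steps M.step n c c') :
    Steps (TM2.step (composeCode M kout cv p)) n
      (liftCfg (fun l => .inr (some l)) none (fun _ => []) c)
      (liftCfg (fun l => .inr (some l)) none (fun _ => []) c') := by
  refine Steps.map (g := TM2.step (composeCode M kout cv p))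
    (liftCfg (fun l => .inr (some l)) none (fun _ => [])) (fun c => ?_) h
  rcases c with ⟨_ | l, v, T⟩
  · rfl
  · exact congrArg some (stepAux_lift _ _ _ _ _ _)

/-- The machine with the code `composeCode`. -/
noncomputable def composeTM [∀ k, Finite (Γ k)] [Finite K] [Fintype (Γ kin)] : FinTM2 where
  K := M.K ⊕ K
  kDecidableEq := inferInstanceAs (DecidableEq (M.K ⊕ K))
  kFin := letI := M.kFin; letI := Fintype.ofFinite K; inferInstanceAs (Fintype (M.K ⊕ K))
  k₀ := .inr kin
  k₁ := .inl M.k₁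
  Γ := CombΓ M.Γ Γ
  Λ := Lab p ⊕ Option M.Λ
  main := .inl (entry p)
  ΛFin := letI := M.ΛFin; letI := finite_lab p; Fintype.ofFinite _
  σ := M.σ × Option (Σ k, Γ k)
  initialState := (M.initialState, none)
  σFin := letI := M.σFin; Fintype.ofFinite _
  Γk₀Fin := inferInstanceAs (Fintype (Γ kin))
  m := composeCode M kout cv p

theorem single_inr (k : K) (l : List (Γ k)) :
    single (Γ := CombΓ Γ₁ Γ) (.inr k) l = comb (fun _ => []) (single k l) := by
  rw [single, single, ← update_comb_inr]
  congr
  funext x; cases x <;> rfl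

theorem single_inl (k : K₁) (l : List (Γ₁ k)) :
    single (Γ := CombΓ Γ₁ Γ) (.inl k) l = comb (single k l) (fun _ => []) := by
  rw [single, single, ← update_comb_inl]
  congr
  funext x; cases x <;> rfl

variable {M kin kout cv p}

/-- The three summands pay for the program, for moving its output, and for `M`. The output stack
differs from the input stack, hence starts empty, so its final length is at most `t`. -/
theorem composeTM_outputs [∀ k, Finite (Γ k)] [Finite K] [Fintype (Γ kin)]
    (hk : kout ≠ kin) {i : List (Γ kin)} {w : List (Γ kout)} {t : ℕ} (h : Runs p (single kin i) (single kout w) t)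
    {o : List (M.Γ M.k₁)} {n : ℕ}
    (hM : TM2OutputsInTime M (w.map fun a => cv (some a)).reverse (some o) n) :
    Nonempty (TM2OutputsInTime (composeTM M kin kout cv p) i (some o) (t + (t + 1) + n)) := by
  obtain ⟨m, hm, r, h₁⟩ := h.steps (composeCode M kout cv p) .inl (.inr none) (fun _ => rfl)
    M.initialState none (fun _ => [])
  have h₂ := steps_composeCode_move M kout cv p M.initialState w r []
  have h₃ := steps_composeCode_lift M kout cv p hM.evals_in_steps
  have hw := h.length_le kout
  have hn := hM.steps_le_m
  simp only [single_self, single_of_ne hk, List.length_nil, zero_add] at hw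
  refine ⟨⟨⟨hM.steps + ((w.length + 1) + m), ?_⟩,
    show hM.steps + ((w.length + 1) + m) ≤ _ by omega⟩⟩
  have hi : initList (composeTM M kin kout cv p) i =
      (⟨some (.inl (entry p)), (M.initialState, none), comb (fun _ => []) (single kin i)⟩ :
        TM2.Cfg (CombΓ M.Γ Γ) (Lab p ⊕ Option M.Λ) (M.σ × Option (Σ k, Γ k))) := by
    have := initList_stk (composeTM M kin kout cv p) i
    rw [show initList (composeTM M kin kout cv p) i = ⟨some (.inl (entry p)),
      (M.initialState, none), (initList (composeTM M kin kout cv p) i).stk⟩ from rfl, this]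
    exact congrArg _ (single_inr kin i)
  have ho : haltList (composeTM M kin kout cv p) o =
      liftCfg (fun l => .inr (some l)) none (fun _ => []) (haltList M o) := by
    have := haltList_stk (composeTM M kin kout cv p) o
    rw [show haltList (composeTM M kin kout cv p) o = ⟨none,
      (M.initialState, none), (haltList (composeTM M kin kout cv p) o).stk⟩ from rfl, this]
    refine congrArg (TM2.Cfg.mk none (M.initialState, none)) ((single_inl M.k₁ o).trans ?_)
    exact congrArg (fun T => comb T _) (haltList_stk M o).symm
  have hl : liftCfg (fun l => .inr (some l)) none (fun _ => [])
      (initList M (w.map fun a => cv (some a)).reverse) =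
      (⟨some (.inr (some M.main)), (M.initialState, none),
        comb (single M.k₀ ((w.map fun a => cv (some a)).reverse ++ [])) fun _ => []⟩ :
        TM2.Cfg (CombΓ M.Γ Γ) (Lab p ⊕ Option M.Λ) (M.σ × Option (Σ k, Γ k))) := by
    rw [List.append_nil]
    exact congrArg (fun T => TM2.Cfg.mk (some (Sum.inr (some M.main))) (M.initialState, none)
      (comb T fun _ => [])) (initList_stk M _)
  rw [single_nil] at h₂
  rw [hl] at h₃
  exact (congrArg (fun c => (flip bind (composeTM M kin kout cv p).step)^[_] (some c)) hi).trans
    (Eq.trans ((h₁.trans h₂).trans h₃) (congrArg some ho.symm))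

end Compose

theorem eval_le_eval (q : Polynomial ℕ) {m n : ℕ} (h : m ≤ n) : q.eval m ≤ q.eval n := by
  rw [Polynomial.eval_eq_sum, Polynomial.eval_eq_sum]
  exact Finset.sum_le_sum fun i _ => Nat.mul_le_mul_left _ (Nat.pow_le_pow_left h i)

/-- If a program translates (the code of) `a` to (the reverse of the code of) `f a` in polynomial
time, then `g ∘ f` is computable in polynomial time whenever `g` is. -/
theorem computableInPolyTime_comp {α β γ αΓ βΓ γΓ : Type} {ea : α → List αΓ} {eb : β → List βΓ}
    {ec : γ → List γΓ} {f : α → β} {g : β → γ} [∀ k, Finite (Γ k)] [Finite K] [Inhabited βΓ]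
    {kin kout : K} (hk : kout ≠ kin) (ein : Γ kin ≃ αΓ) (conv : Γ kout → βΓ) (p : Prog Γ)
    (q : Polynomial ℕ)
    (h : ∀ a, ∃ w : List (Γ kout), (w.map conv).reverse = eb (f a) ∧
      Runs p (single kin ((ea a).map ein.symm)) (single kout w) (q.eval (ea a).length))
    (M : TM2ComputableInPolyTime eb ec g) :
    Nonempty (TM2ComputableInPolyTime ea ec (g ∘ f)) := by
  let _ := Fintype.ofFinite (Γ kin)
  -- A symbol is pushed only after a successful pop, so `default` is never used.
  let cv : Option (Γ kout) → M.tm.Γ M.tm.k₀ := fun a =>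
    M.inputAlphabet.symm ((a.map conv).getD default)
  refine ⟨⟨⟨composeTM M.tm kin kout cv p, ein, M.outputAlphabet⟩,
    -- The length of `eb (f a)` is at most `q` of the input length, and polynomials over `ℕ` are
    -- monotone, so the time of `M` is at most `M.time` evaluated at that bound.
    q + (q + 1) + M.time.comp q, fun a => Classical.choice ?_⟩⟩
  obtain ⟨w, hw, hr⟩ := h a
  have hM := M.outputsFun (f a)
  have hw' : (eb (f a)).map M.inputAlphabet.invFun = (w.map fun a => cv (some a)).reverse := by
    rw [← hw, List.map_reverse, List.map_map]; rfl
  rw [hw'] at hM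
  obtain ⟨H⟩ := composeTM_outputs hk hr hM
  refine ⟨⟨H.toEvalsTo, H.steps_le_m.trans ?_⟩⟩
  have hl := hr.length_le kout
  simp only [single_self, single_of_ne hk, List.length_nil, zero_add] at hl
  have hlen : (eb (f a)).length = w.length := by simp [← hw]
  have := eval_le_eval M.time (hlen.trans_le hl)
  simp only [Polynomial.eval_add, Polynomial.eval_one, Polynomial.eval_comp]
  omega

end StackProg

/-! ### Stores with counters and words -/

namespace RelCSP

open StackProg Function

/-- Working alphabet: symbols, and unary numbers with an end marker. -/
inductive WLetter (ρ : Type) : Type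
  | sym (a : Option ρ) : WLetter ρ
  | tick : WLetter ρ
  | mark : WLetter ρ

inductive Cnt : Type
  | base | val | cur | tmp | src | sav | ovf
  deriving DecidableEq

inductive Wrd : Type
  | eqs | fcts | word | rev
  deriving DecidableEq

/-- The stacks: the input, counters, and words over the working alphabet. -/
inductive Stk : Type
  | inp : Stk
  | cnt (c : Cnt) : Stk
  | wrd (w : Wrd) : Stk
  deriving DecidableEq

instance : Finite Cnt :=
  Finite.of_surjective (fun i : Fin 7 => ![Cnt.base, .val, .cur, .tmp, .src, .sav, .ovf] i)
    fun c => by cases c <;> decide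

instance : Finite Wrd :=
  Finite.of_surjective (fun i : Fin 4 => ![Wrd.eqs, .fcts, .word, .rev] i)
    fun c => by cases c <;> decide

instance : Finite Stk :=
  Finite.of_surjective
    (fun o : Option (Cnt ⊕ Wrd) => o.elim Stk.inp (Sum.elim Stk.cnt Stk.wrd))
    fun k => match k with
      | .inp => ⟨none, rfl⟩
      | .cnt c => ⟨some (.inl c), rfl⟩
      | .wrd w => ⟨some (.inr w), rfl⟩

/-- The alphabets of the stacks. -/
@[reducible]
def StkΓ (ι ρ : Type) : Stk → Type
  | .inp => ι
  | .cnt _ => Unit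
  | .wrd _ => WLetter ρ

variable {ι ρ : Type}

/-- A store: the input, the values of the counters, and the words. -/
@[ext]
structure St (ι ρ : Type) where
  inp : List ι
  cnt : Cnt → ℕ
  wrd : Wrd → List (WLetter ρ)

/-- The stacks that represent a store. -/
def St.stk (s : St ι ρ) : ∀ k, List (StkΓ ι ρ k)
  | .inp => s.inp
  | .cnt c => List.replicate (s.cnt c) ()
  | .wrd w => s.wrd w

theorem St.update_inp (s : St ι ρ) (l : List ι) :
    update s.stk .inp l = St.stk ⟨l, s.cnt, s.wrd⟩ := by
  funext k
  rcases k with _ | c | w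
  · simp [stk]
  · rw [update_of_ne (by simp)]; rfl
  · rw [update_of_ne (by simp)]; rfl

theorem St.update_cnt (s : St ι ρ) (c : Cnt) (n : ℕ) :
    update s.stk (.cnt c) (List.replicate n ()) = St.stk ⟨s.inp, update s.cnt c n, s.wrd⟩ := by
  funext k
  rcases k with _ | c' | w
  · rw [update_of_ne (by simp)]; rfl
  · rcases eq_or_ne c' c with rfl | h
    · simp [stk]
    · rw [update_of_ne (by simpa using h)]; simp [stk, update_of_ne h]
  · rw [update_of_ne (by simp)]; rfl

theorem St.update_wrd (s : St ι ρ) (w : Wrd) (l : List (WLetter ρ)) :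
    update s.stk (.wrd w) l = St.stk ⟨s.inp, s.cnt, update s.wrd w l⟩ := by
  funext k
  rcases k with _ | c | w'
  · rw [update_of_ne (by simp)]; rfl
  · rw [update_of_ne (by simp)]; rfl
  · rcases eq_or_ne w' w with rfl | h
    · simp [stk]
    · rw [update_of_ne (by simpa using h)]; simp [stk, update_of_ne h]

abbrev SProg (ι ρ : Type) := Prog (StkΓ ι ρ)

/-- `Go p s s' t`: the program `p` leads from the store `s` to the store `s'` in at most `t`
steps. -/
def Go (p : SProg ι ρ) (s s' : St ι ρ) (t : ℕ) : Prop :=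
  Runs p s.stk s'.stk t

infixr:60 " ⊳ " => Prog.seq

theorem Go.seq {p q : SProg ι ρ} {s s' s'' : St ι ρ} {t t' : ℕ} (h : Go p s s' t)
    (h' : Go q s' s'' t') : Go (p ⊳ q) s s'' (t + t') :=
  Runs.seq h h'

theorem Go.mono {p : SProg ι ρ} {s s' : St ι ρ} {t t' : ℕ} (h : Go p s s' t) (ht : t ≤ t') :
    Go p s s' t' :=
  Runs.mono h ht

theorem Go.congr {p : SProg ι ρ} {s s' s'' : St ι ρ} {t t' : ℕ} (h : Go p s s' t)
    (hs : s' = s'') (ht : t ≤ t') : Go p s s'' t' :=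
  hs ▸ h.mono ht

theorem Go.skip (s : St ι ρ) : Go .skip s s 1 := Runs.skip _

theorem Go.inc (c : Cnt) (s : St ι ρ) :
    Go (.push (.cnt c) ()) s ⟨s.inp, update s.cnt c (s.cnt c + 1), s.wrd⟩ 1 := by
  have := Runs.push (Γ := StkΓ ι ρ) (.cnt c) () s.stk
  rwa [show () :: s.stk (.cnt c) = List.replicate (s.cnt c + 1) () from rfl, St.update_cnt] at this

theorem Go.dec (c : Cnt) (s : St ι ρ) :
    Go (.pop (.cnt c)) s ⟨s.inp, update s.cnt c (s.cnt c - 1), s.wrd⟩ 1 := by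
  have := Runs.pop (Γ := StkΓ ι ρ) (.cnt c) s.stk
  rwa [show (s.stk (.cnt c)).tail = List.replicate (s.cnt c - 1) () from List.tail_replicate,
    St.update_cnt] at this

theorem Go.pushW (w : Wrd) (a : WLetter ρ) (s : St ι ρ) :
    Go (.push (.wrd w) a) s ⟨s.inp, s.cnt, update s.wrd w (a :: s.wrd w)⟩ 1 := by
  have := Runs.push (Γ := StkΓ ι ρ) (.wrd w) a s.stk
  rwa [St.update_wrd] at this

theorem Go.popW (w : Wrd) (s : St ι ρ) :
    Go (.pop (.wrd w)) s ⟨s.inp, s.cnt, update s.wrd w (s.wrd w).tail⟩ 1 := by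
  have := Runs.pop (Γ := StkΓ ι ρ) (.wrd w) s.stk
  rwa [St.update_wrd] at this

theorem Go.popI (s : St ι ρ) :
    Go (.pop .inp) s ⟨s.inp.tail, s.cnt, s.wrd⟩ 1 := by
  have := Runs.pop (Γ := StkΓ ι ρ) .inp s.stk
  rwa [St.update_inp] at this

theorem Go.peek {k : Stk} {f : Option (StkΓ ι ρ k) → SProg ι ρ} {s s' : St ι ρ} {t : ℕ}
    {o : Option (StkΓ ι ρ k)} (ho : (s.stk k).head? = o) (h : Go (f o) s s' t) :
    Go (.peek k f) s s' (t + 1) :=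
  Runs.peek (ho ▸ h)

theorem Go.loop_done {k : Stk} {c : Option (StkΓ ι ρ k) → Bool} {p : SProg ι ρ} {s : St ι ρ}
    (h : c (s.stk k).head? = false) : Go (.loop k c p) s s 1 :=
  Runs.loop_done h

theorem Go.loop_step {k : Stk} {c : Option (StkΓ ι ρ k) → Bool} {p : SProg ι ρ}
    {s s' s'' : St ι ρ} {t t' : ℕ} (h : c (s.stk k).head? = true) (hp : Go p s s' t)
    (hl : Go (.loop k c p) s' s'' t') : Go (.loop k c p) s s'' (t + t' + 1) :=
  Runs.loop_step h hp hl

/-- `I j` is the store after `j` rounds. Each round costs its body and one test, and one further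
test leaves the loop. -/
theorem Go.loop_iterate {k : Stk} {c : Option (StkΓ ι ρ k) → Bool} {p : SProg ι ρ} {t : ℕ}
    (n : ℕ) (I : ℕ → St ι ρ) (hc : ∀ j < n, c ((I j).stk k).head? = true)
    (hn : c ((I n).stk k).head? = false) (hp : ∀ j < n, Go p (I j) (I (j + 1)) t) :
    Go (.loop k c p) (I 0) (I n) (n * (t + 1) + 1) := by
  induction n generalizing I with
  | zero => exact (Go.loop_done hn).mono (by omega)
  | succ n ih =>
    refine (Go.loop_step (hc 0 (by omega)) (hp 0 (by omega)) (ih (fun j => I (j + 1))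
      (fun j hj => hc _ (by omega)) hn fun j hj => hp _ (by omega))).mono ?_
    rw [Nat.succ_mul]; omega

theorem head_cnt (s : St ι ρ) (c : Cnt) :
    (s.stk (.cnt c)).head?.isSome = decide (s.cnt c ≠ 0) := by
  simp only [St.stk]
  cases s.cnt c <;> simp

/-- Loop on a counter. -/
theorem Go.loop_cnt {c : Cnt} {p : SProg ι ρ} {t : ℕ} (I : ℕ → St ι ρ) (n : ℕ)
    (hI : ∀ j ≤ n, (I j).cnt c = n - j) (hp : ∀ j < n, Go p (I j) (I (j + 1)) t) :
    Go (.loop (.cnt c) Option.isSome p) (I 0) (I n) (n * (t + 1) + 1) := by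
  refine Go.loop_iterate n I (fun j hj => ?_) ?_ hp
  · rw [head_cnt, hI j hj.le]; simp; omega
  · rw [head_cnt, hI n le_rfl]; simp

/-! ### Basic programs -/

/-- Reset a counter. -/
def drain (c : Cnt) : SProg ι ρ :=
  .loop (.cnt c) Option.isSome (.pop (.cnt c))

theorem go_drain (c : Cnt) (s : St ι ρ) :
    Go (drain c) s ⟨s.inp, update s.cnt c 0, s.wrd⟩ (2 * s.cnt c + 1) := by
  have := Go.loop_cnt (c := c) (p := .pop (.cnt c)) (t := 1)
    (fun j => ⟨s.inp, update s.cnt c (s.cnt c - j), s.wrd⟩) (s.cnt c) (by simp)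
    (fun j _ => (Go.dec c _).congr (by simp [Nat.sub_sub]) le_rfl)
  simp only [Nat.sub_zero, update_eq_self, Nat.sub_self] at this
  exact this.mono (by omega)

/-- Add the counter `i` to the counter `j` and reset `i`. -/
def transfer (i j : Cnt) : SProg ι ρ :=
  .loop (.cnt i) Option.isSome (.pop (.cnt i) ⊳ .push (.cnt j) ())

theorem go_transfer {i j : Cnt} (hij : i ≠ j) (s : St ι ρ) :
    Go (transfer i j) s ⟨s.inp, update (update s.cnt j (s.cnt j + s.cnt i)) i 0, s.wrd⟩
      (3 * s.cnt i + 1) := by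
  have := Go.loop_cnt (c := i) (p := .pop (.cnt i) ⊳ .push (.cnt j) ()) (t := 2)
    (fun k => ⟨s.inp, update (update s.cnt j (s.cnt j + k)) i (s.cnt i - k), s.wrd⟩)
    (s.cnt i) (by simp)
    (fun k _ => ((Go.dec i _).seq (Go.inc j _)).congr
      (by simp [Nat.sub_sub, update_of_ne hij.symm, update_comm hij, add_assoc]) le_rfl)
  simp only [Nat.sub_zero, add_zero, update_eq_self, Nat.sub_self] at this
  exact this.mono (by omega)

/-- Push the value of the counter `c` in unary. -/
def copy (c : Cnt) (o : Wrd) : SProg ι ρ :=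
  .loop (.cnt c) Option.isSome (.pop (.cnt c) ⊳ .push (.cnt .tmp) () ⊳ .push (.wrd o) .tick) ⊳
    transfer .tmp c

/-- Counting a stack down destroys it, so its ticks are parked in `tmp` and moved back afterwards.
Hence `tmp` must start at zero and differ from `c`. -/
theorem go_copy {c : Cnt} (hc : c ≠ .tmp) (o : Wrd) (s : St ι ρ) (hs : s.cnt .tmp = 0) :
    Go (copy c o) s ⟨s.inp, s.cnt,
      update s.wrd o (List.replicate (s.cnt c) WLetter.tick ++ s.wrd o)⟩ (7 * s.cnt c + 2) := by
  have := Go.loop_cnt (c := c)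
    (p := .pop (.cnt c) ⊳ .push (.cnt .tmp) () ⊳ .push (.wrd o) .tick) (t := 3)
    (fun k => ⟨s.inp, update (update s.cnt .tmp (s.cnt .tmp + k)) c (s.cnt c - k),
      update s.wrd o (List.replicate k WLetter.tick ++ s.wrd o)⟩)
    (s.cnt c) (by simp)
    (fun k _ => ((Go.dec c _).seq ((Go.inc .tmp _).seq (Go.pushW o _ _))).congr
      (by simp [Nat.sub_sub, update_of_ne hc.symm, update_comm hc, add_assoc,
        List.replicate_succ]) le_rfl)
  simp only [Nat.sub_zero, add_zero, update_eq_self, Nat.sub_self, List.replicate_zero,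
    List.nil_append, hs, zero_add] at this
  have e : update (update s.cnt .tmp 0) c (s.cnt c) = s.cnt := by
    rw [← hs, update_eq_self, update_eq_self]
  rw [e] at this
  refine (this.seq (go_transfer hc.symm _)).congr ?_ ?_
  · rw [St.mk.injEq]
    refine ⟨rfl, ?_, rfl⟩
    funext x
    rcases eq_or_ne x .tmp with rfl | hx
    · simp [hs]
    · rcases eq_or_ne x c with rfl | hx'
      · simp [hx, hx.symm]
      · simp [hx, hx']
  · simp [update_of_ne hc.symm]; omega

/-- Move the contents of a word to another one, reversing it. -/
def moveW (i j : Wrd) : SProg ι ρ :=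
  .loop (.wrd i) Option.isSome (.peek (.wrd i) fun a => match a with
    | some a => .pop (.wrd i) ⊳ .push (.wrd j) a
    | none => .skip)

theorem go_moveW {i j : Wrd} (hij : i ≠ j) (s : St ι ρ) :
    Go (moveW i j) s ⟨s.inp, s.cnt, update (update s.wrd j ((s.wrd i).reverse ++ s.wrd j)) i []⟩
      (4 * (s.wrd i).length + 1) := by
  obtain ⟨l, hl⟩ : ∃ l, l = s.wrd i := ⟨_, rfl⟩
  induction l generalizing s with
  | nil =>
    refine (Go.loop_done ?_).congr ?_ (by omega)
    · simp [St.stk, ← hl]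
    · ext1 <;> simp [← hl]
  | cons a l ih =>
    refine (Go.loop_step ?_ (Go.peek (o := some a) ?_ ((Go.popW i _).seq (Go.pushW j _ _)))
      (ih _ ?_)).congr ?_ ?_
    · simp [St.stk, ← hl]
    · simp [St.stk, ← hl]
    · simp [← hl, hij]
    · ext1 <;> simp [← hl, hij, hij.symm, update_comm hij]
    · simp [← hl, hij]; omega

/-- Run a list of programs one after the other. -/
def seqs (l : List (SProg ι ρ)) : SProg ι ρ :=
  l.foldr Prog.seq Prog.skip

theorem go_inc (c : Cnt) (k : ℕ) (s : St ι ρ) :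
    Go (seqs (List.replicate k (.push (.cnt c) ()))) s
      ⟨s.inp, update s.cnt c (s.cnt c + k), s.wrd⟩ (k + 1) := by
  induction k generalizing s with
  | zero => exact (Go.skip s).congr (by ext1 <;> simp) le_rfl
  | succ k ih =>
    exact ((Go.inc c s).seq (ih _)).congr (by simp [add_assoc, add_comm 1]) (by omega)

theorem go_ticks (w : Wrd) (k : ℕ) (s : St ι ρ) :
    Go (seqs (List.replicate k (.push (.wrd w) .tick))) s
      ⟨s.inp, s.cnt, update s.wrd w (List.replicate k WLetter.tick ++ s.wrd w)⟩ (k + 1) := by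
  induction k generalizing s with
  | zero => exact (Go.skip s).congr (by ext1 <;> simp) le_rfl
  | succ k ih =>
    exact ((Go.pushW w _ s).seq (ih _)).congr (by
      simp [List.replicate_succ', List.append_assoc]) (by omega)

end RelCSP

/-! ### Generating the glued structure -/

namespace RelCSP

open StackProg Function

variable {ι ρ : Type}

/-- Tokens of a word over the working alphabet: symbols and numbers. -/
inductive Tok (ρ : Type) : Type
  | sym (a : Option ρ) : Tok ρ
  | num (n : ℕ) : Tok ρ

def encTok : Tok ρ → List (WLetter ρ)
  | .sym a => [.sym a]
  | .num n => List.replicate n .tick ++ [.mark]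

def enc (l : List (Tok ρ)) : List (WLetter ρ) := l.flatMap encTok

@[simp] theorem enc_nil : enc ([] : List (Tok ρ)) = [] := rfl

@[simp] theorem enc_cons (x : Tok ρ) (l : List (Tok ρ)) : enc (x :: l) = encTok x ++ enc l := rfl

@[simp] theorem enc_append (l l' : List (Tok ρ)) : enc (l ++ l') = enc l ++ enc l' :=
  List.flatMap_append

/-- Output instructions: a symbol, or the sum of a counter and a constant. -/
inductive Out (ρ : Type) : Type
  | sym (a : Option ρ) : Out ρ
  | num (c : Cnt) (k : ℕ) : Out ρ

def Out.val (C : Cnt → ℕ) : Out ρ → Tok ρ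
  | .sym a => .sym a
  | .num c k => .num (C c + k)

/-- The numbers that are output are at most `K`. -/
def Out.Bounded (C : Cnt → ℕ) (K : ℕ) : Out ρ → Prop
  | .sym _ => True
  | .num c k => c ≠ .tmp ∧ C c + k ≤ K

def emit (o : Wrd) : Out ρ → SProg ι ρ
  | .sym a => .push (.wrd o) (.sym a)
  | .num c k => copy c o ⊳ seqs (List.replicate k (.push (.wrd o) .tick)) ⊳ .push (.wrd o) .mark

/-- Words are built by pushing, so they lie reversed on their stack until `moveW` turns them round.
-/
theorem go_emit (o : Wrd) (x : Out ρ) (s : St ι ρ) (hs : s.cnt .tmp = 0) {K : ℕ}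
    (hx : x.Bounded s.cnt K) :
    Go (emit o x) s ⟨s.inp, s.cnt, update s.wrd o ((encTok (x.val s.cnt)).reverse ++ s.wrd o)⟩
      (7 * K + 5) := by
  cases x with
  | sym a => exact (Go.pushW o _ s).mono (by omega)
  | num c k =>
    obtain ⟨hc, hk⟩ := hx
    refine ((go_copy hc o s hs).seq ((go_ticks o k _).seq (Go.pushW o _ _))).congr ?_ (by omega)
    simp [Out.val, encTok, ← List.append_assoc, add_comm k]

def emitL (o : Wrd) (l : List (Out ρ)) : SProg ι ρ := seqs (l.map (emit o))

theorem go_emitL (o : Wrd) (l : List (Out ρ)) (s : St ι ρ) (hs : s.cnt .tmp = 0) {K : ℕ}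
    (hl : ∀ x ∈ l, x.Bounded s.cnt K) :
    Go (emitL o l) s ⟨s.inp, s.cnt, update s.wrd o ((enc (l.map (Out.val s.cnt))).reverse ++ s.wrd o)⟩
      (l.length * (7 * K + 5) + 1) := by
  induction l generalizing s with
  | nil => exact (Go.skip s).congr (by simp) (by omega)
  | cons x l ih =>
    rw [List.forall_mem_cons] at hl
    refine ((go_emit o x s hs hl.1).seq (ih _ hs hl.2)).congr (by simp) ?_
    rw [List.length_cons, Nat.succ_mul l.length]; omega

def Tok.shift (b : ℕ) : Tok ρ → Tok ρ
  | .sym a => .sym a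
  | .num n => .num (b + n)

/-- The instruction that outputs a token, shifted by the counter `base`. -/
def Tok.out : Tok ρ → Out ρ
  | .sym a => .sym a
  | .num n => .num .base n

theorem Tok.val_out (C : Cnt → ℕ) (x : Tok ρ) : x.out.val C = x.shift (C .base) := by
  cases x <;> rfl

theorem go_emitL_out (o : Wrd) (l : List (Tok ρ)) (s : St ι ρ) (hs : s.cnt .tmp = 0) {K : ℕ}
    (hl : ∀ n, Tok.num n ∈ l → s.cnt .base + n ≤ K) :
    Go (emitL o (l.map Tok.out)) s
      ⟨s.inp, s.cnt, update s.wrd o ((enc (l.map (Tok.shift (s.cnt .base)))).reverse ++ s.wrd o)⟩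
      (l.length * (7 * K + 5) + 1) := by
  refine (go_emitL o _ s hs (K := K) fun x hx => ?_).congr ?_ (by simp)
  · obtain ⟨y, hy, rfl⟩ := List.mem_map.1 hx
    cases y with
    | sym a => trivial
    | num n => exact ⟨by simp, hl n hy⟩
  · simp [Function.comp_def, Tok.val_out]

/-- The combinatorial data of a pattern. The elements of `P` are the numbers below `nP`, those of
`Q R` the numbers below `nQ R`; the facts of these structures are written as words. -/
structure Gadget (τ : FirstOrder.Language.{0, 0}) (ρ : Type) where
  nP : ℕ
  outP : List (Tok ρ)
  nQ : (Σ r, τ.Relations r) → ℕ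
  outQ : (Σ r, τ.Relations r) → List (Tok ρ)
  q : ∀ R : (Σ r, τ.Relations r), Fin R.1 → ℕ → ℕ
  outP_lt : ∀ n, Tok.num n ∈ outP → n < nP
  outQ_lt : ∀ R n, Tok.num n ∈ outQ R → n < nQ R
  q_lt : ∀ R i p, p < nP → q R i p < nQ R

variable {τ : FirstOrder.Language.{0, 0}}

def isTick : Option (Letter τ) → Bool
  | some .tick => true
  | _ => false

/-- Read a number from the input, and add `P` times this number to the counter `val`. -/
def readScaled (P : ℕ) : SProg (Letter τ) ρ :=
  .loop .inp isTick (.pop .inp ⊳ seqs (List.replicate P (.push (.cnt .val) ()))) ⊳ .pop .inp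

/-- Pushing `P` ticks for each tick read multiplies by the constant `P`. The result is the first
number of the copy of `P` that belongs to the element `x`. -/
theorem go_readScaled (P x : ℕ) (rest : List (Letter τ)) (s : St (Letter τ) ρ)
    (hs : s.inp = encodeNat τ x ++ rest) :
    Go (readScaled P) s ⟨rest, update s.cnt .val (s.cnt .val + x * P), s.wrd⟩
      (x * (P + 3) + 2) := by
  have key : Go (ρ := ρ)
      (.loop .inp isTick (.pop .inp ⊳ seqs (List.replicate P (.push (.cnt .val) ())))) s
      ⟨Letter.mark :: rest, update s.cnt .val (s.cnt .val + x * P), s.wrd⟩ (x * (P + 3) + 1) := by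
    induction x generalizing s with
    | zero =>
      refine (Go.loop_done ?_).congr ?_ (by omega)
      · simp [St.stk, hs, encodeNat, isTick]
      · ext1 <;> simp [hs, encodeNat]
    | succ x ih =>
      refine (Go.loop_step ?_ ((Go.popI s).seq (go_inc .val P _)) (ih _ ?_)).congr ?_ ?_
      · simp [St.stk, hs, encodeNat, isTick, List.replicate_succ]
      · simp [hs, encodeNat, List.replicate_succ]
      · simp [add_mul, add_assoc, add_comm P]
      · rw [Nat.succ_mul x]; omega
  exact (key.seq (Go.popI _)).congr (by simp) (by omega)

namespace Gadget

variable (G : Gadget τ ρ)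

/-- The equations for the `i`-th entry `x` of a tuple in the relation `R`. -/
def eqArg (b : ℕ) (R : Σ r, τ.Relations r) (i : Fin R.1) (x : ℕ) : List (ℕ × ℕ) :=
  (List.range G.nP).map fun p => (b + G.q R i p, x * G.nP + p)

end Gadget

/-- An equation as a word. -/
def eqToks (l : List (ℕ × ℕ)) : List (Tok ρ) :=
  l.flatMap fun e => [.sym none, .num e.1, .num e.2]

@[simp] theorem eqToks_nil : eqToks (ρ := ρ) [] = [] := rfl

@[simp] theorem eqToks_cons (e : ℕ × ℕ) (l : List (ℕ × ℕ)) :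
    eqToks (ρ := ρ) (e :: l) = .sym none :: .num e.1 :: .num e.2 :: eqToks l := rfl

@[simp] theorem eqToks_append (l l' : List (ℕ × ℕ)) :
    eqToks (ρ := ρ) (l ++ l') = eqToks l ++ eqToks l' :=
  List.flatMap_append

namespace Gadget

variable (G : Gadget τ ρ)

def genArg (R : Σ r, τ.Relations r) (i : Fin R.1) : SProg (Letter τ) ρ :=
  readScaled G.nP ⊳
    emitL .eqs ((List.range G.nP).flatMap fun p =>
      [.sym none, .num .base (G.q R i p), .num .val p]) ⊳ drain .val

/-- A time bound for `genArg`. -/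
def argTime (K : ℕ) : ℕ := K * (G.nP + 3) + 3 * G.nP * (7 * K + 5) + 2 * K + 4

theorem go_genArg (R : Σ r, τ.Relations r) (i : Fin R.1) (x K : ℕ) (rest : List (Letter τ))
    (s : St (Letter τ) ρ) (hs : s.inp = encodeNat τ x ++ rest) (ht : s.cnt .tmp = 0)
    (hv : s.cnt .val = 0) (hb : s.cnt .base + G.nQ R ≤ K) (hx : x ≤ K)
    (hx' : x * G.nP + G.nP ≤ K) :
    Go (G.genArg R i) s ⟨rest, s.cnt, update s.wrd .eqs
      ((enc (eqToks (G.eqArg (s.cnt .base) R i x))).reverse ++ s.wrd .eqs)⟩ (G.argTime K) := by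
  refine ((go_readScaled G.nP x rest s hs).seq ((go_emitL (K := K) _ _ _ ?_ ?_).seq
    (go_drain _ _))).congr ?_ ?_
  · simpa using ht
  · intro y hy
    obtain ⟨p, hp, hy⟩ := List.mem_flatMap.1 hy
    rw [List.mem_range] at hp
    have hq := G.q_lt R i p hp
    simp only [List.mem_cons, List.not_mem_nil, or_false] at hy
    rcases hy with rfl | rfl | rfl
    · trivial
    · exact ⟨by simp, by simp; omega⟩
    · exact ⟨by simp, by simp [hv]; omega⟩
  · simp only [eqArg, eqToks, List.map_flatMap, List.flatMap_map, hv, zero_add, update_idem]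
    rw [St.mk.injEq]
    refine ⟨rfl, ?_, ?_⟩
    · rw [← hv, update_eq_self]
    · simp [Out.val]
  · have h₁ : x * (G.nP + 3) ≤ K * (G.nP + 3) := Nat.mul_le_mul_right _ hx
    have h₂ : ((List.range G.nP).flatMap fun p =>
      [Out.sym none, .num .base (G.q R i p), (.num .val p : Out ρ)]).length = 3 * G.nP := by
      simp [List.length_flatMap, mul_comm]
    simp only [argTime, h₂, update_self, hv]
    omega

/-- The gadget `Q R` for a fact, its elements numbered from `base` on. -/
def genRel (R : Σ r, τ.Relations r) : SProg (Letter τ) ρ :=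
  seqs ((List.finRange R.1).map (G.genArg R)) ⊳ emitL .fcts ((G.outQ R).map Tok.out) ⊳
    seqs (List.replicate (G.nQ R) (.push (.cnt .base) ()))

theorem go_genArgs (R : Σ r, τ.Relations r) (l : List (Fin R.1)) (x : Fin R.1 → ℕ) (K : ℕ)
    (rest : List (Letter τ)) (s : St (Letter τ) ρ)
    (hs : s.inp = l.flatMap (fun i => encodeNat τ (x i)) ++ rest) (ht : s.cnt .tmp = 0)
    (hv : s.cnt .val = 0) (hb : s.cnt .base + G.nQ R ≤ K) (hx : ∀ i, x i ≤ K)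
    (hx' : ∀ i, x i * G.nP + G.nP ≤ K) :
    Go (seqs (l.map (G.genArg R))) s ⟨rest, s.cnt, update s.wrd .eqs
      ((enc (eqToks (l.flatMap fun i => G.eqArg (s.cnt .base) R i (x i)))).reverse ++ s.wrd .eqs)⟩
      (l.length * G.argTime K + 1) := by
  induction l generalizing s with
  | nil => exact (Go.skip s).congr (by ext1 <;> simp [hs]) (by omega)
  | cons i l ih =>
    refine ((G.go_genArg R i (x i) K (l.flatMap (fun i => encodeNat τ (x i)) ++ rest) s
      (by simp [hs]) ht hv hb (hx i) (hx' i)).seq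
      (ih ⟨_, s.cnt, _⟩ rfl ht hv hb)).congr (by simp) ?_
    rw [List.length_cons, Nat.succ_mul l.length]; omega

theorem go_genRel (R : Σ r, τ.Relations r) (x : Fin R.1 → ℕ) (K D : ℕ)
    (rest : List (Letter τ)) (s : St (Letter τ) ρ)
    (hs : s.inp = (List.finRange R.1).flatMap (fun i => encodeNat τ (x i)) ++ rest)
    (ht : s.cnt .tmp = 0) (hv : s.cnt .val = 0) (hb : s.cnt .base + G.nQ R ≤ K)
    (hx : ∀ i, x i ≤ K) (hx' : ∀ i, x i * G.nP + G.nP ≤ K) (hD : R.1 ≤ D)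
    (hD' : (G.outQ R).length ≤ D) (hD'' : G.nQ R ≤ D) :
    Go (G.genRel R) s ⟨rest, update s.cnt .base (s.cnt .base + G.nQ R),
      update (update s.wrd .eqs ((enc (eqToks ((List.finRange R.1).flatMap fun i =>
        G.eqArg (s.cnt .base) R i (x i)))).reverse ++ s.wrd .eqs)) .fcts
        ((enc ((G.outQ R).map (Tok.shift (s.cnt .base)))).reverse ++ s.wrd .fcts)⟩
      (D * G.argTime K + D * (7 * K + 5) + D + 3) := by
  have h w := go_emitL_out (K := K) .fcts (G.outQ R) ⟨rest, s.cnt, w⟩ ht fun n hn => by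
    have := G.outQ_lt R n hn
    simp only; omega
  refine ((G.go_genArgs R _ x K rest s hs ht hv hb hx hx').seq
    ((h _).seq (go_inc _ _ _))).congr ?_ ?_
  · simp
  · have h₁ := Nat.mul_le_mul_right (G.argTime K) hD
    have h₂ := Nat.mul_le_mul_right (7 * K + 5) hD'
    simp only [List.length_finRange]
    omega

end Gadget

end RelCSP

/-! ### Gadgets for all elements and all facts of the input -/

namespace RelCSP

open StackProg Function

variable {ι ρ : Type} {τ : FirstOrder.Language.{0, 0}}

namespace Gadget

variable (G : Gadget τ ρ)

/-- The facts of `n` copies of `P`, numbered from `b` on. -/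
def elemToks (b : ℕ) : ℕ → List (Tok ρ)
  | 0 => []
  | n + 1 => G.outP.map (Tok.shift b) ++ elemToks (b + G.nP) n

def genElems : SProg (Letter τ) ρ :=
  .loop .inp isTick (.pop .inp ⊳ emitL .fcts (G.outP.map Tok.out) ⊳
    seqs (List.replicate G.nP (.push (.cnt .base) ()))) ⊳ .pop .inp

/-- The universe size is read in unary, one copy of `P` per tick, with `base` always the next unused
number. At the end `base` is where the copies of the `Q R` begin. -/
theorem go_genElems (n K : ℕ) (rest : List (Letter τ)) (s : St (Letter τ) ρ)
    (hs : s.inp = encodeNat τ n ++ rest) (ht : s.cnt .tmp = 0)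
    (hK : s.cnt .base + n * G.nP ≤ K) :
    Go G.genElems s ⟨rest, update s.cnt .base (s.cnt .base + n * G.nP),
      update s.wrd .fcts ((enc (G.elemToks (s.cnt .base) n)).reverse ++ s.wrd .fcts)⟩
      (n * (G.outP.length * (7 * K + 5) + G.nP + 4) + 2) := by
  have key : Go (.loop .inp isTick (.pop .inp ⊳ emitL .fcts (G.outP.map Tok.out) ⊳
      seqs (List.replicate G.nP (.push (.cnt .base) ())))) s
      ⟨Letter.mark :: rest, update s.cnt .base (s.cnt .base + n * G.nP),
        update s.wrd .fcts ((enc (G.elemToks (s.cnt .base) n)).reverse ++ s.wrd .fcts)⟩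
      (n * (G.outP.length * (7 * K + 5) + G.nP + 4) + 1) := by
    induction n generalizing s with
    | zero =>
      refine (Go.loop_done ?_).congr ?_ (by omega)
      · simp [St.stk, hs, encodeNat, isTick]
      · ext1 <;> simp [hs, encodeNat, elemToks]
    | succ n ih =>
      rw [add_mul, one_mul] at hK
      have h (w : List (Letter τ)) := go_emitL_out (K := K) .fcts G.outP ⟨w, s.cnt, s.wrd⟩ ht fun k hk => by
        have := G.outP_lt k hk
        simp only; omega
      refine (Go.loop_step ?_ ((Go.popI s).seq ((h _).seq (go_inc .base G.nP _)))
        (ih _ ?_ ?_ ?_)).congr ?_ ?_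
      · simp [St.stk, hs, encodeNat, isTick, List.replicate_succ]
      · simp [hs, encodeNat, List.replicate_succ]
      · simpa using ht
      · simp; omega
      · simp [add_mul, elemToks, add_assoc, add_comm G.nP]
      · rw [Nat.succ_mul n]; omega
  exact (key.seq (Go.popI _)).congr (by simp) (by omega)

variable {n : ℕ}

/-- The relation symbol of a fact. -/
def rel (F : Σ r : ℕ, τ.Relations r × (Fin r → Fin n)) : Σ r, τ.Relations r := ⟨F.1, F.2.1⟩

/-- The equations for a fact, its gadget numbered from `b` on. -/
def eqFact (b : ℕ) (F : Σ r : ℕ, τ.Relations r × (Fin r → Fin n)) : List (ℕ × ℕ) :=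
  (List.finRange F.1).flatMap fun i => G.eqArg b (rel F) i (F.2.2 i)

def genEqs (b : ℕ) : List (Σ r : ℕ, τ.Relations r × (Fin r → Fin n)) → List (ℕ × ℕ)
  | [] => []
  | F :: l => G.eqFact b F ++ genEqs (b + G.nQ (rel F)) l

def genToks (b : ℕ) : List (Σ r : ℕ, τ.Relations r × (Fin r → Fin n)) → List (Tok ρ)
  | [] => []
  | F :: l => (G.outQ (rel F)).map (Tok.shift b) ++ genToks (b + G.nQ (rel F)) l

/-- The first number not used for the gadgets of a list of facts. -/
def total (b : ℕ) : List (Σ r : ℕ, τ.Relations r × (Fin r → Fin n)) → ℕ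
  | [] => b
  | F :: l => total (b + G.nQ (rel F)) l

theorem le_total (b : ℕ) (l : List (Σ r : ℕ, τ.Relations r × (Fin r → Fin n))) :
    b ≤ G.total b l := by
  induction l generalizing b with
  | nil => exact le_rfl
  | cons F l ih => exact (Nat.le_add_right _ _).trans (ih _)

def genFacts : SProg (Letter τ) ρ :=
  .loop .inp Option.isSome (.peek .inp fun a => match a with
    | some (.rel R) => .pop .inp ⊳ G.genRel ⟨_, R⟩
    | _ => .skip)

/-- A time bound for `genRel`. -/
def relTime (D K : ℕ) : ℕ := D * G.argTime K + D * (7 * K + 5) + D + 3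

/-- As `base` only grows, bounding its final value `total` by `K` bounds all numbers written on the
way, and every fact costs at most `relTime D K`. -/
theorem go_genFacts (l : List (Σ r : ℕ, τ.Relations r × (Fin r → Fin n))) (K D : ℕ)
    (s : St (Letter τ) ρ)
    (hs : s.inp = l.flatMap fun F =>
      Letter.rel F.2.1 :: (List.ofFn F.2.2).flatMap fun x : Fin n => encodeNat τ (x : ℕ))
    (ht : s.cnt .tmp = 0) (hv : s.cnt .val = 0) (hb : G.total (s.cnt .base) l ≤ K)
    (hn : n ≤ K) (hn' : n * G.nP ≤ K) (hD : ∀ R : Σ r, τ.Relations r, R.1 ≤ D)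
    (hD' : ∀ R, (G.outQ R).length ≤ D) (hD'' : ∀ R, G.nQ R ≤ D) :
    Go G.genFacts s ⟨[], update s.cnt .base (G.total (s.cnt .base) l),
      update (update s.wrd .eqs ((enc (eqToks (G.genEqs (s.cnt .base) l))).reverse ++ s.wrd .eqs))
        .fcts ((enc (G.genToks (s.cnt .base) l)).reverse ++ s.wrd .fcts)⟩
      (l.length * (G.relTime D K + 3) + 1) := by
  induction l generalizing s with
  | nil =>
    refine (Go.loop_done ?_).congr ?_ (by omega)
    · simp [St.stk, hs]
    · ext1
      · simp [hs]
      · simp [total]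
      · funext w; cases w <;> simp [genEqs, genToks]
  | cons F l ih =>
    have hb' := (G.le_total (s.cnt .base + G.nQ (rel F)) l).trans hb
    have hx (i : Fin F.1) : (F.2.2 i : ℕ) * G.nP + G.nP ≤ K := by
      have := Nat.mul_le_mul_right G.nP (F.2.2 i).2
      rw [Nat.succ_mul (F.2.2 i : ℕ)] at this
      omega
    have h := G.go_genRel (rel F) (fun i => (F.2.2 i : ℕ)) K D
      (l.flatMap fun F => Letter.rel F.2.1 ::
        (List.ofFn F.2.2).flatMap fun x : Fin n => encodeNat τ (x : ℕ))
      ⟨s.inp.tail, s.cnt, s.wrd⟩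
      (by simp [hs, List.ofFn_eq_map, List.flatMap_map, rel]) ht hv hb'
      (fun i => (F.2.2 i).2.le.trans hn) hx (hD _) (hD' _) (hD'' _)
    refine (Go.loop_step ?_ (Go.peek (o := some (Letter.rel F.2.1)) ?_ ((Go.popI s).seq h))
      (ih _ ?_ ?_ ?_ ?_)).congr ?_ ?_
    · simp [St.stk, hs]
    · simp [St.stk, hs]
    · rfl
    · simpa using ht
    · simpa using hv
    · simpa [total] using hb
    · ext1
      · rfl
      · simp [total]
      · funext w; cases w <;> simp [genEqs, genToks, eqFact, rel]
    · rw [List.length_cons, Nat.succ_mul l.length]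
      simp only [relTime]
      omega

end Gadget

/-! ### Eliminating equations -/

def isTickW : Option (WLetter ρ) → Bool
  | some .tick => true
  | _ => false

def isEqW : Option (WLetter ρ) → Bool
  | some (.sym none) => true
  | _ => false

def readNum (c : Cnt) : SProg ι ρ :=
  .loop (.wrd .word) isTickW (.pop (.wrd .word) ⊳ .push (.cnt c) ()) ⊳ .pop (.wrd .word)

theorem go_readNum (c : Cnt) (x : ℕ) (rest : List (WLetter ρ)) (s : St ι ρ)
    (hs : s.wrd .word = encTok (.num x) ++ rest) :
    Go (readNum c) s ⟨s.inp, update s.cnt c (s.cnt c + x), update s.wrd .word rest⟩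
      (3 * x + 2) := by
  have key : Go (.loop (.wrd .word) isTickW (.pop (.wrd .word) ⊳ .push (.cnt c) ())) s
      ⟨s.inp, update s.cnt c (s.cnt c + x), update s.wrd .word (.mark :: rest)⟩ (3 * x + 1) := by
    induction x generalizing s with
    | zero =>
      refine (Go.loop_done ?_).congr ?_ (by omega)
      · simp [St.stk, hs, encTok, isTickW]
      · have : .mark :: rest = s.wrd .word := by simp [hs, encTok]
        ext1 <;> simp [this]
    | succ x ih =>
      refine (Go.loop_step ?_ ((Go.popW .word s).seq (Go.inc c _)) (ih _ ?_)).congr ?_ ?_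
      · simp [St.stk, hs, encTok, isTickW, List.replicate_succ]
      · simp [hs, encTok, List.replicate_succ]
      · simp [add_assoc, add_comm 1]
      · omega
  exact (key.seq (Go.popW _ _)).congr (by simp) (by omega)

/-- Read a number `x`; the parts of `x` below and above the counter `src` are counted in `sav` and
`ovf`. -/
def readCmp : SProg ι ρ :=
  .loop (.wrd .word) isTickW (.pop (.wrd .word) ⊳ .push (.cnt .cur) () ⊳
    .peek (.cnt .src) fun a => match a with
      | some _ => .pop (.cnt .src) ⊳ .push (.cnt .sav) ()
      | none => .push (.cnt .ovf) ()) ⊳ .pop (.wrd .word)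

/-- Each tick of `x` is matched against a tick of `src` while any is left. Truncated subtraction
describes both leftovers, and `src` can be rebuilt from `sav`. -/
theorem go_readCmp (x : ℕ) (rest : List (WLetter ρ)) (s : St ι ρ)
    (hs : s.wrd .word = encTok (.num x) ++ rest) :
    Go readCmp s ⟨s.inp, update (update (update (update s.cnt .cur (s.cnt .cur + x))
      .src (s.cnt .src - x)) .sav (s.cnt .sav + min (s.cnt .src) x))
      .ovf (s.cnt .ovf + (x - s.cnt .src)), update s.wrd .word rest⟩
      (6 * x + 2) := by
  have key : Go (.loop (.wrd .word) isTickW (.pop (.wrd .word) ⊳ .push (.cnt .cur) () ⊳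
    .peek (.cnt .src) fun a => match a with
      | some _ => .pop (.cnt .src) ⊳ .push (.cnt .sav) ()
      | none => .push (.cnt .ovf) ())) s ⟨s.inp, update (update (update (update s.cnt .cur
        (s.cnt .cur + x)) .src (s.cnt .src - x)) .sav (s.cnt .sav + min (s.cnt .src) x))
      .ovf (s.cnt .ovf + (x - s.cnt .src)), update s.wrd .word (.mark :: rest)⟩ (6 * x + 1) := by
    induction x generalizing s with
    | zero =>
      refine (Go.loop_done ?_).congr ?_ (by omega)
      · simp [St.stk, hs, encTok, isTickW]
      · have : .mark :: rest = s.wrd .word := by simp [hs, encTok]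
        ext1 <;> simp [this]
    | succ x ih =>
      rcases hsrc : s.cnt .src with _ | u
      · refine (Go.loop_step ?_ ((Go.popW .word s).seq ((Go.inc .cur _).seq
          (Go.peek (o := none) ?_ (Go.inc .ovf _)))) (ih _ ?_)).congr ?_ ?_
        · simp [St.stk, hs, encTok, isTickW, List.replicate_succ]
        · simp [St.stk, hsrc]
        · simp [hs, encTok, List.replicate_succ]
        · ext1
          · rfl
          · funext c; cases c <;> simp [hsrc]; all_goals omega
          · simp
        · omega
      · refine (Go.loop_step ?_ ((Go.popW .word s).seq ((Go.inc .cur _).seq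
          (Go.peek (o := some ()) ?_ ((Go.dec .src _).seq (Go.inc .sav _))))) (ih _ ?_)).congr ?_ ?_
        · simp [St.stk, hs, encTok, isTickW, List.replicate_succ]
        · simp [St.stk, hsrc, List.replicate_succ]
        · simp [hs, encTok, List.replicate_succ]
        · ext1
          · rfl
          · funext c; cases c <;> simp [hsrc]; all_goals omega
          · simp
        · omega
  exact (key.seq (Go.popW _ _)).congr (by simp) (by omega)

end RelCSP

namespace RelCSP

open StackProg Function

variable {ι ρ : Type} {τ : FirstOrder.Language.{0, 0}}

/-- Copy the next number, replacing the value of `src` by the value of `val`. -/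
def substNum : SProg ι ρ :=
  readCmp ⊳ (.peek (.cnt .src) fun a => match a with
    | some _ => copy .cur .rev
    | none => .peek (.cnt .ovf) fun a => match a with
      | some _ => copy .cur .rev
      | none => copy .val .rev) ⊳ .push (.wrd .rev) .mark ⊳ drain .cur ⊳ drain .ovf ⊳
    transfer .sav .src

/-- The store condition between two programs: the auxiliary counters are zero. -/
structure St.Clean (s : St ι ρ) : Prop where
  cur : s.cnt .cur = 0
  tmp : s.cnt .tmp = 0
  sav : s.cnt .sav = 0
  ovf : s.cnt .ovf = 0

/-- The numbers agree iff nothing is left over on either side, that is, `src` and `ovf` are both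
zero after the comparison. Only then `val` is written in place of `cur`. -/
theorem go_substNum (x K : ℕ) (rest : List (WLetter ρ)) (s : St ι ρ)
    (hs : s.wrd .word = encTok (.num x) ++ rest) (hc : s.Clean) (hx : x ≤ K)
    (hu : s.cnt .src ≤ K) (hv : s.cnt .val ≤ K) :
    Go substNum s ⟨s.inp, s.cnt, update (update s.wrd .word rest) .rev
      ((encTok (.num (if x = s.cnt .src then s.cnt .val else x))).reverse ++ s.wrd .rev)⟩
      (20 * K + 20) := by
  obtain ⟨hcur, htmp, hsav, hovf⟩ := hc
  obtain ⟨s', h₁, hi', hc', hw'⟩ : ∃ s', Go readCmp s s' (6 * x + 2) ∧ s'.inp = s.inp ∧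
      s'.cnt = update (update (update (update s.cnt .cur (s.cnt .cur + x))
        .src (s.cnt .src - x)) .sav (s.cnt .sav + min (s.cnt .src) x))
        .ovf (s.cnt .ovf + (x - s.cnt .src)) ∧ s'.wrd = update s.wrd .word rest :=
    ⟨_, go_readCmp x rest s hs, rfl, rfl, rfl⟩
  have h₂ :
      Go (.peek (.cnt .src) fun a => match a with
        | some _ => copy .cur .rev
        | none => .peek (.cnt .ovf) fun a => match a with
          | some _ => copy .cur .rev
          | none => copy .val .rev) s' ⟨s'.inp, s'.cnt, update s'.wrd .rev
        (List.replicate (if x = s.cnt .src then s.cnt .val else x) .tick ++ s'.wrd .rev)⟩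
        (7 * K + 4) := by
    have e₁ : s'.cnt .src = s.cnt .src - x := by simp [hc']
    have e₂ : s'.cnt .ovf = x - s.cnt .src := by simp [hc', hovf]
    have e₃ : s'.cnt .cur = x := by simp [hc', hcur]
    have e₄ : s'.cnt .val = s.cnt .val := by simp [hc']
    have e₅ : s'.cnt .tmp = 0 := by simp [hc', htmp]
    rcases lt_trichotomy x (s.cnt .src) with h | h | h
    · obtain ⟨k, hk⟩ : ∃ k, s'.cnt .src = k + 1 := ⟨s.cnt .src - x - 1, by omega⟩
      refine (Go.peek (o := some ()) ?_ (go_copy (by simp) _ _ e₅)).congr ?_ ?_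
      · simp [St.stk, hk, List.replicate_succ]
      · rw [e₃, if_neg h.ne]
      · rw [e₃]; omega
    · refine (Go.peek (o := none) ?_ (Go.peek (o := none) ?_
        (go_copy (by simp) _ _ e₅))).congr ?_ ?_
      · simp [St.stk, e₁, h]
      · simp [St.stk, e₂, h]
      · rw [e₄, if_pos h]
      · rw [e₄]; omega
    · obtain ⟨k, hk⟩ : ∃ k, s'.cnt .ovf = k + 1 := ⟨x - s.cnt .src - 1, by omega⟩
      refine (Go.peek (o := none) ?_ (Go.peek (o := some ()) ?_
        (go_copy (by simp) _ _ e₅))).congr ?_ ?_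
      · simp [St.stk, e₁, Nat.sub_eq_zero_of_le h.le]
      · simp [St.stk, hk, List.replicate_succ]
      · rw [e₃, if_neg h.ne']
      · rw [e₃]; omega
  refine (h₁.seq (h₂.seq ((Go.pushW _ _ _).seq ((go_drain _ _).seq
    ((go_drain _ _).seq (go_transfer (i := .sav) (j := .src) (by simp) _)))))).congr ?_ ?_
  · ext1
    · exact hi'
    · funext c
      cases c <;> simp [hc', hcur, htmp, hsav, hovf]
    · funext w
      cases w <;> simp [hw', encTok]
  · simp [hc', hcur, hsav, hovf]
    have := min_le_left (s.cnt .src) x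
    omega

def Tok.subst (e : ℕ × ℕ) : Tok ρ → Tok ρ
  | .sym a => .sym a
  | .num n => .num (if n = e.1 then e.2 else n)

/-- Substitute in the whole word. -/
def substWord : SProg ι ρ :=
  .loop (.wrd .word) Option.isSome (.peek (.wrd .word) fun a => match a with
    | some (.sym a) => .pop (.wrd .word) ⊳ .push (.wrd .rev) (.sym a)
    | _ => substNum)

theorem encTok_num_head (x : ℕ) : (encTok (.num x : Tok ρ)).head? = some .tick ∨
    (encTok (.num x : Tok ρ)).head? = some .mark := by
  cases x <;> simp [encTok, List.replicate_succ]

theorem go_substWord (l : List (Tok ρ)) (K : ℕ) (s : St ι ρ) (hs : s.wrd .word = enc l)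
    (hc : s.Clean) (hl : ∀ n, Tok.num n ∈ l → n ≤ K) (hu : s.cnt .src ≤ K)
    (hv : s.cnt .val ≤ K) :
    Go substWord s ⟨s.inp, s.cnt, update (update s.wrd .word []) .rev
      ((enc (l.map (Tok.subst (s.cnt .src, s.cnt .val)))).reverse ++ s.wrd .rev)⟩
      (l.length * (20 * K + 22) + 1) := by
  induction l generalizing s with
  | nil =>
    refine (Go.loop_done ?_).congr ?_ (by omega)
    · simp [St.stk, hs]
    · ext1
      · rfl
      · rfl
      · funext w; cases w <;> simp [hs]
  | cons x l ih =>
    have ih' w hw := ih ⟨s.inp, s.cnt, w⟩ hw ⟨hc.1, hc.2, hc.3, hc.4⟩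
      (fun n hn => hl n (by simp [hn])) hu hv
    cases x with
    | sym a =>
      have h := (Go.popW .word s).seq (Go.pushW .rev (.sym a) _)
      refine (Go.loop_step ?_ (Go.peek (o := some (WLetter.sym a)) ?_ h) (ih' _ ?_)).congr ?_ ?_
      · simp [St.stk, hs, encTok]
      · simp [St.stk, hs, encTok]
      · simp [hs, encTok]
      · ext1
        · rfl
        · rfl
        · funext w; cases w <;> simp [Tok.subst, encTok]
      · rw [List.length_cons, Nat.succ_mul l.length]; omega
    | num n =>
      have h : Go (.peek (.wrd .word) fun a => match a with
          | some (.sym a) => .pop (.wrd .word) ⊳ .push (.wrd .rev) (.sym a)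
          | _ => substNum) s ⟨s.inp, s.cnt, update (update s.wrd .word (enc l)) .rev
            ((encTok (.num (if n = s.cnt .src then s.cnt .val else n))).reverse ++ s.wrd .rev)⟩
          (20 * K + 21) := by
        have h := go_substNum n K (enc l) s hs hc (hl n (by simp)) hu hv
        rcases encTok_num_head (ρ := ρ) n with hn | hn
        · exact Go.peek (o := some WLetter.tick) (by simp [St.stk, hs, hn]) h
        · exact Go.peek (o := some WLetter.mark) (by simp [St.stk, hs, hn]) h
      refine (Go.loop_step ?_ h (ih' _ ?_)).congr ?_ ?_
      · rcases encTok_num_head (ρ := ρ) n with hn | hn <;> simp [St.stk, hs, hn]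
      · simp
      · ext1
        · rfl
        · rfl
        · funext w; cases w <;> simp [Tok.subst]
      · rw [List.length_cons, Nat.succ_mul l.length]; omega

/-- Eliminate the equations at the front of the word. -/
def elim : SProg ι ρ :=
  .loop (.wrd .word) isEqW (.pop (.wrd .word) ⊳ readNum .src ⊳ readNum .val ⊳ substWord ⊳
    moveW .rev .word ⊳ drain .src ⊳ drain .val)

def substEq (e : ℕ × ℕ) (e' : ℕ × ℕ) : ℕ × ℕ :=
  (if e'.1 = e.1 then e.2 else e'.1, if e'.2 = e.1 then e.2 else e'.2)

/-- The result of eliminating equations from a word. -/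
def elimToks : List (ℕ × ℕ) → List (Tok ρ) → List (Tok ρ)
  | [], l => l
  | e :: E, l => elimToks (E.map (substEq e)) (l.map (Tok.subst e))
termination_by E => E.length

theorem eqToks_subst (e : ℕ × ℕ) (E : List (ℕ × ℕ)) :
    (eqToks E : List (Tok ρ)).map (Tok.subst e) = eqToks (E.map (substEq e)) := by
  induction E with
  | nil => rfl
  | cons e' E ih => simp [ih, Tok.subst, substEq]

theorem length_enc_le (l : List (Tok ρ)) (K : ℕ) (hl : ∀ n, Tok.num n ∈ l → n ≤ K) :
    (enc l).length ≤ l.length * (K + 1) := by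
  induction l with
  | nil => simp
  | cons x l ih =>
    have := ih fun n hn => hl n (by simp [hn])
    rw [enc_cons, List.length_append, List.length_cons, Nat.succ_mul]
    have : (encTok x).length ≤ K + 1 := by
      cases x with
      | sym a => simp [encTok]
      | num n => simpa [encTok] using hl n (by simp)
    omega

theorem length_eqToks (E : List (ℕ × ℕ)) : (eqToks E : List (Tok ρ)).length = 3 * E.length := by
  induction E with
  | nil => rfl
  | cons e E ih => simp [ih]; omega

theorem subst_le {K : ℕ} {e : ℕ × ℕ} (he : e.2 ≤ K) {l : List (Tok ρ)}
    (hl : ∀ n, Tok.num n ∈ l → n ≤ K) (n : ℕ) (hn : Tok.num n ∈ l.map (Tok.subst e)) : n ≤ K := by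
  obtain ⟨x, hx, hx'⟩ := List.mem_map.1 hn
  cases x with
  | sym a => simp [Tok.subst] at hx'
  | num m =>
    simp only [Tok.subst, Tok.num.injEq] at hx'
    have := hl m hx
    split_ifs at hx' <;> omega

/-- A time bound for eliminating one equation from a word of `m` tokens. -/
def elimTime (m K : ℕ) : ℕ := m * (20 * K + 22) + 4 * (m * (K + 1)) + 10 * K + 20

/-- The loop runs as long as the word starts with an equation marker, so `l` must contain none. A
round uses up one equation, never increases the number of tokens, and introduces only numbers
already present; the bounds `m` and `K` persist and every round costs at most `elimTime m K`. -/
theorem go_elim (E : List (ℕ × ℕ)) (l : List (Tok ρ)) (m K : ℕ) (s : St ι ρ)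
    (hs : s.wrd .word = enc (eqToks E ++ l)) (hr : s.wrd .rev = [])
    (hc : s.Clean) (hu : s.cnt .src = 0) (hv : s.cnt .val = 0)
    (hl : Tok.sym none ∉ l) (hK : ∀ n, Tok.num n ∈ eqToks E ++ l → n ≤ K)
    (hm : (eqToks E ++ l).length ≤ m) :
    Go elim s ⟨s.inp, s.cnt, update s.wrd .word (enc (elimToks E l))⟩
      (E.length * elimTime m K + 1) := by
  obtain ⟨k, hk⟩ : ∃ k, k = E.length := ⟨_, rfl⟩
  induction k generalizing E l s with
  | zero =>
    obtain rfl : E = [] := List.length_eq_zero_iff.1 hk.symm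
    refine (Go.loop_done ?_).congr ?_ (by omega)
    · rcases l with _ | ⟨x, l⟩
      · simp [St.stk, hs, isEqW]
      · rcases x with (_ | a) | n
        · simp at hl
        · simp [St.stk, hs, isEqW, encTok]
        · rcases encTok_num_head (ρ := ρ) n with hn | hn <;> simp [St.stk, hs, hn, isEqW]
    · ext1
      · rfl
      · rfl
      · simp [elimToks, ← hs.trans (by simp : _ = enc l)]
  | succ k ih =>
    obtain _ | ⟨e, E⟩ := E
    · simp at hk
    have he₁ : e.1 ≤ K := hK _ (by simp)
    have he₂ : e.2 ≤ K := hK _ (by simp)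
    have hK' : ∀ n, Tok.num n ∈ (eqToks E ++ l : List (Tok ρ)) → n ≤ K := fun n hn =>
      hK n (by simp at hn ⊢; tauto)
    have hm' : (eqToks E ++ l).length + 3 ≤ m := by
      simp at hm ⊢; omega
    have hlen := length_enc_le _ K (subst_le he₂ hK')
    have hlen' : ((eqToks E ++ l).map (Tok.subst e)).length ≤ m := by
      rw [List.length_map]; omega
    -- The unit subtracted from `elimTime m K` pays for the loop test.
    have body : Go (.pop (.wrd .word) ⊳ readNum .src ⊳ readNum .val ⊳ substWord ⊳
        moveW .rev .word ⊳ drain .src ⊳ drain .val) s ⟨s.inp, s.cnt, update s.wrd .word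
          (enc (eqToks (E.map (substEq e)) ++ l.map (Tok.subst e)))⟩ (elimTime m K - 1) := by
      refine ((Go.popW .word s).seq ((go_readNum .src e.1
        (encTok (.num e.2) ++ enc (eqToks E ++ l)) _ ?_).seq ((go_readNum .val e.2
        (enc (eqToks E ++ l)) _ ?_).seq ((go_substWord (eqToks E ++ l) K _ ?_ ?_ hK' ?_ ?_).seq
        ((go_moveW (by simp) _).seq ((go_drain _ _).seq (go_drain _ _))))))).congr ?_ ?_
      · simp [hs, encTok]
      · simp
      · simp
      · constructor <;> simp [hc.cur, hc.tmp, hc.sav, hc.ovf]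
      · simpa [hu] using he₁
      · simpa [hv] using he₂
      · ext1
        · rfl
        · funext c; cases c <;> simp [hu, hv]
        · funext w
          cases w <;> simp [hr, hu, hv, ← eqToks_subst]
      · simp only [update_self, ne_eq, reduceCtorEq, not_false_eq_true, update_of_ne, hu, hv, hr,
          zero_add, List.append_nil, List.length_reverse, Prod.mk.eta]
        have h₁ := Nat.mul_le_mul_right (20 * K + 22) ((Nat.le_add_right _ 3).trans hm')
        have h₂ := hlen.trans (Nat.mul_le_mul_right (K + 1) hlen')
        simp only [elimTime]
        omega
    refine (Go.loop_step ?_ body (ih (E.map (substEq e)) (l.map (Tok.subst e)) _ ?_ ?_ ?_ ?_ ?_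
      ?_ ?_ ?_ ?_)).congr ?_ ?_
    · simp [St.stk, hs, encTok, isEqW]
    · simp
    · simpa using hr
    · exact ⟨hc.1, hc.2, hc.3, hc.4⟩
    · exact hu
    · exact hv
    · intro h
      obtain ⟨x, hx, hx'⟩ := List.mem_map.1 h
      cases x with
      | sym a => simp only [Tok.subst, Tok.sym.injEq] at hx'; subst hx'; exact hl (by simpa using hx)
      | num n => simp [Tok.subst] at hx'
    · rw [← eqToks_subst, ← List.map_append]; exact subst_le he₂ hK'
    · rw [← eqToks_subst, ← List.map_append]; exact hlen'
    · simpa using hk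
    · simp [elimToks]
    · rw [List.length_cons, Nat.succ_mul E.length, List.length_map]
      have : 1 ≤ elimTime m K := by simp only [elimTime]; omega
      omega

end RelCSP

/-! ### Bounds on the numbers in use, and the whole translation program -/

namespace RelCSP

open StackProg Function

variable {ρ : Type} {τ : FirstOrder.Language.{0, 0}}

/-- The tail is rewritten before the recursive call, so only the length of the list of equations
decreases and structural induction does not apply. -/
theorem elimToks_induction {motive : List (ℕ × ℕ) → List (Tok ρ) → Prop}
    (nil : ∀ l, motive [] l)
    (cons : ∀ e E l, motive (E.map (substEq e)) (l.map (Tok.subst e)) → motive (e :: E) l)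
    (E : List (ℕ × ℕ)) (l : List (Tok ρ)) : motive E l := by
  obtain ⟨k, hk⟩ : ∃ k, k = E.length := ⟨_, rfl⟩
  induction k generalizing E l with
  | zero => rw [List.length_eq_zero_iff.1 hk.symm]; exact nil l
  | succ k ih =>
    cases E with
    | nil => simp at hk
    | cons e E => exact cons e E l (ih _ _ (by simpa using hk))

theorem length_elimToks (E : List (ℕ × ℕ)) (l : List (Tok ρ)) :
    (elimToks E l).length = l.length := by
  induction E, l using elimToks_induction with
  | nil l => simp [elimToks]
  | cons e E l ih => simpa [elimToks] using ih

theorem elimToks_le (E : List (ℕ × ℕ)) (l : List (Tok ρ)) {K : ℕ}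
    (h : ∀ n, Tok.num n ∈ eqToks E ++ l → n ≤ K) : ∀ n, Tok.num n ∈ elimToks E l → n ≤ K := by
  induction E, l using elimToks_induction with
  | nil l => simpa [elimToks] using h
  | cons e E l ih =>
    rw [elimToks]
    refine ih ?_
    rw [← eqToks_subst, ← List.map_append]
    exact subst_le (h _ (by simp)) fun n hn => h n (by simp at hn ⊢; tauto)

namespace Gadget

variable (G : Gadget τ ρ) {n : ℕ}

theorem elemToks_lt (b k x : ℕ) (hx : Tok.num x ∈ G.elemToks b k) : x < b + k * G.nP := by
  induction k generalizing b with
  | zero => simp [elemToks] at hx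
  | succ k ih =>
    rw [elemToks, List.mem_append] at hx
    rw [Nat.succ_mul]
    rcases hx with hx | hx
    · obtain ⟨t, ht, hx⟩ := List.mem_map.1 hx
      cases t with
      | sym a => simp [Tok.shift] at hx
      | num y =>
        simp only [Tok.shift, Tok.num.injEq] at hx
        have := G.outP_lt y ht
        omega
    · have := ih _ hx
      omega

theorem genToks_lt (b x : ℕ) (l : List (Σ r : ℕ, τ.Relations r × (Fin r → Fin n)))
    (hx : Tok.num x ∈ G.genToks b l) : x < G.total b l := by
  induction l generalizing b with
  | nil => simp [genToks] at hx
  | cons F l ih =>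
    rw [genToks, List.mem_append] at hx
    rcases hx with hx | hx
    · obtain ⟨t, ht, hx⟩ := List.mem_map.1 hx
      cases t with
      | sym a => simp [Tok.shift] at hx
      | num y =>
        simp only [Tok.shift, Tok.num.injEq] at hx
        have := G.outQ_lt _ y ht
        have := G.le_total (b + G.nQ (rel F)) l
        rw [total]
        omega
    · exact ih _ hx

/-- Left-hand sides lie in the gadget blocks counted by `total`; right-hand sides lie in the copies
of `P`, which `hb` keeps below `b`. -/
theorem genEqs_lt (b : ℕ) (hb : n * G.nP ≤ b) (e : ℕ × ℕ)
    (l : List (Σ r : ℕ, τ.Relations r × (Fin r → Fin n)))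
    (he : e ∈ G.genEqs b l) : e.1 < G.total b l ∧ e.2 < G.total b l := by
  induction l generalizing b with
  | nil => simp [genEqs] at he
  | cons F l ih =>
    rw [genEqs, List.mem_append] at he
    rcases he with he | he
    · obtain ⟨i, -, he⟩ := List.mem_flatMap.1 he
      obtain ⟨p, hp, rfl⟩ := List.mem_map.1 he
      rw [List.mem_range] at hp
      have := G.q_lt (rel F) i p hp
      have := G.le_total (b + G.nQ (rel F)) l
      have h := Nat.mul_le_mul_right G.nP (F.2.2 i).2
      rw [Nat.succ_mul (F.2.2 i : ℕ)] at h
      rw [total]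
      simp only
      omega
    · exact ih _ (by omega) he

/-- The equations of the glued structure of an input. -/
def eqs (B : Input τ) : List (ℕ × ℕ) := G.genEqs (B.size * G.nP) B.facts

/-- The word of the facts of the glued structure, before gluing. -/
def toks (B : Input τ) : List (Tok ρ) :=
  G.elemToks 0 B.size ++ G.genToks (B.size * G.nP) B.facts

/-- The number of elements of the glued structure, before gluing. -/
def card (B : Input τ) : ℕ := G.total (B.size * G.nP) B.facts

theorem mem_eqToks (x : ℕ) (E : List (ℕ × ℕ)) (h : (Tok.num x : Tok ρ) ∈ eqToks E) :
    ∃ e ∈ E, x = e.1 ∨ x = e.2 := by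
  obtain ⟨e, he, h⟩ := List.mem_flatMap.1 h
  exact ⟨e, he, by simpa using h⟩

theorem mem_lt_card (B : Input τ) (x : ℕ) (hx : Tok.num x ∈ eqToks (G.eqs B) ++ G.toks B) :
    x < G.card B := by
  have hle := G.le_total (B.size * G.nP) B.facts
  rw [List.mem_append, toks, List.mem_append] at hx
  rcases hx with hx | hx | hx
  · obtain ⟨e, he, rfl | rfl⟩ := mem_eqToks _ _ hx
    · exact (G.genEqs_lt _ le_rfl e _ he).1
    · exact (G.genEqs_lt _ le_rfl e _ he).2
  · have := G.elemToks_lt _ _ _ hx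
    rw [zero_add] at this
    exact this.trans_le hle
  · exact G.genToks_lt _ _ _ hx

/-- The symbol that marks equations does not occur in the words of the gadgets. -/
def NoEq (G : Gadget τ ρ) : Prop :=
  Tok.sym none ∉ G.outP ∧ ∀ R, Tok.sym none ∉ G.outQ R

variable {G} in
theorem NoEq.toks (h : G.NoEq) (B : Input τ) : Tok.sym none ∉ G.toks B := by
  have key : ∀ (b : ℕ) (l : List (Tok ρ)), Tok.sym none ∈ l.map (Tok.shift b) →
      Tok.sym none ∈ l := by
    intro b l hl
    obtain ⟨x, hx, hx'⟩ := List.mem_map.1 hl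
    cases x with
    | sym a => exact hx' ▸ hx
    | num y => simp [Tok.shift] at hx'
  rw [Gadget.toks, List.mem_append]
  rintro (hx | hx)
  · generalize 0 = b at hx
    generalize B.size = k at hx
    induction k generalizing b with
    | zero => simp [elemToks] at hx
    | succ k ih =>
      rw [elemToks, List.mem_append] at hx
      exact hx.elim (fun hx => h.1 (key _ _ hx)) (ih _)
  · generalize B.size * G.nP = b at hx
    generalize B.facts = l at hx
    induction l generalizing b with
    | nil => simp [genToks] at hx
    | cons F l ih =>
      rw [genToks, List.mem_append] at hx
      exact hx.elim (fun hx => h.2 _ (key _ _ hx)) (ih _)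

/-- The program that computes the glued structure. -/
def translate : SProg (Letter τ) ρ :=
  G.genElems ⊳ G.genFacts ⊳ moveW .fcts .word ⊳ moveW .eqs .word ⊳ elim ⊳
    .push (.wrd .word) .mark ⊳ copy .base .word ⊳ drain .base ⊳ moveW .word .rev

/-- A time bound for `translate`, for inputs with `n` elements and `f` facts, when there are at
most `e` equations, at most `m` tokens, and all numbers are at most `K`. -/
def translateTime (D n f e m K : ℕ) : ℕ :=
  n * (G.outP.length * (7 * K + 5) + G.nP + 4) + f * (G.relTime D K + 3) + e * elimTime m K +
    12 * (m * (K + 1)) + 13 * K + 30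

/-- Facts are moved to `word` before the equations, so the equations come out on top, where `elim`
expects them. The universe size is pushed last and thus heads the word; the final `moveW` reverses
it as the composition of machines requires. -/
theorem go_translate (hG : G.NoEq) (B : Input τ) (D m K : ℕ)
    (hD : ∀ R : Σ r, τ.Relations r, R.1 ≤ D)
    (hD' : ∀ R, (G.outQ R).length ≤ D) (hD'' : ∀ R, G.nQ R ≤ D)
    (hm : (eqToks (G.eqs B) ++ G.toks B).length ≤ m) (hK : G.card B ≤ K) (hK' : B.size ≤ K) :
    Runs G.translate (single Stk.inp B.encode) (single (Γ := StkΓ (Letter τ) ρ) (Stk.wrd .rev)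
      (List.replicate (G.card B) WLetter.tick ++ WLetter.mark :: enc (elimToks (G.eqs B) (G.toks B))).reverse)
      (G.translateTime D B.size B.facts.length (G.eqs B).length m K) := by
  have hle : B.size * G.nP ≤ G.card B := G.le_total (B.size * G.nP) B.facts
  have hnum : ∀ x, Tok.num x ∈ eqToks (G.eqs B) ++ G.toks B → x ≤ K :=
    fun x hx => (G.mem_lt_card B x hx).le.trans hK
  have hl₁ : (enc (G.toks B)).length ≤ m * (K + 1) :=
    (length_enc_le _ K fun x hx => hnum x (by simp [hx])).trans
      (Nat.mul_le_mul_right _ ((by simp : _ ≤ _).trans hm))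
  have hl₂ : (enc (eqToks (G.eqs B) : List (Tok ρ))).length ≤ m * (K + 1) :=
    (length_enc_le _ K fun x hx => hnum x (by simp [hx])).trans
      (Nat.mul_le_mul_right _ ((by simp : _ ≤ _).trans hm))
  have hl₃ : (enc (elimToks (G.eqs B) (G.toks B))).length ≤ m * (K + 1) :=
    (length_enc_le _ K (elimToks_le _ _ hnum)).trans
      (Nat.mul_le_mul_right _ (by rw [length_elimToks]; exact (by simp : _ ≤ _).trans hm))
  have h : Go G.translate ⟨B.encode, fun _ => 0, fun _ => []⟩ ⟨[], fun _ => 0, update (fun _ => [])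
      .rev (List.replicate (G.card B) WLetter.tick ++
        WLetter.mark :: enc (elimToks (G.eqs B) (G.toks B))).reverse⟩
      (G.translateTime D B.size B.facts.length (G.eqs B).length m K) := by
    refine ((G.go_genElems B.size K _ _ rfl rfl ?_).seq ((G.go_genFacts B.facts K D _ rfl ?_ ?_ ?_
      hK' (hle.trans hK) hD hD' hD'').seq ((go_moveW (by simp) _).seq ((go_moveW (by simp) _).seq
      ((go_elim (G.eqs B) (G.toks B) m K _ ?_ ?_ ?_ ?_ ?_ (hG.toks B) hnum hm).seq
      ((Go.pushW _ _ _).seq ((go_copy (by simp) _ _ ?_).seq ((go_drain _ _).seq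
        (go_moveW (by simp) _))))))))).congr ?_ ?_
    · simpa using hle.trans hK
    · simp
    · simp
    · simpa [card] using hK
    · simp [toks, eqs]
    · simp
    · constructor <;> simp
    · simp
    · simp
    · simp
    · ext1
      · rfl
      · funext c; cases c <;> simp
      · funext w; cases w <;> simp [card]
    · simp only [translateTime]
      simp only [update_self, ne_eq, reduceCtorEq, not_false_eq_true, update_of_ne,
        List.append_nil, List.length_reverse, List.length_append, List.length_cons,
        List.length_replicate, zero_add]
      rw [toks, enc_append, List.length_append] at hl₁
      rw [eqs] at hl₂
      rw [card] at hK
      omega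
  -- Stores with all counters zero and a single non-empty stack are the initial and final families
  -- of stacks in the composition.
  have e₁ : St.stk ⟨B.encode, fun _ => 0, fun _ => []⟩ =
      single (Γ := StkΓ (Letter τ) ρ) Stk.inp B.encode := by
    rw [single, ← St.update_inp ⟨[], fun _ => 0, fun _ => []⟩]
    congr 1
    funext k; cases k <;> rfl
  have e₂ (l : List (WLetter ρ)) : St.stk ⟨[], fun _ => 0, update (fun _ => []) .rev l⟩ =
      single (Γ := StkΓ (Letter τ) ρ) (Stk.wrd .rev) l := by
    rw [single, ← St.update_wrd ⟨[], fun _ => 0, fun _ => []⟩]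
    congr 1
    funext k; cases k <;> rfl
  rwa [Go, e₁, e₂] at h

end Gadget

end RelCSP

/-! ### Homomorphisms from the glued structure -/

namespace RelCSP

open Function FirstOrder Language

variable {σ τ : FirstOrder.Language.{0, 0}}

/-- A tuple of numbers in a relation. -/
abbrev NFact (σ : FirstOrder.Language.{0, 0}) : Type := Σ r : ℕ, σ.Relations r × (Fin r → ℕ)

def NFact.map (g : ℕ → ℕ) (F : NFact σ) : NFact σ := ⟨F.1, F.2.1, g ∘ F.2.2⟩

/-- The tuple holds in `A` when its entries are evaluated by `h`. -/
def NFact.Holds {A : Type*} [σ.Structure A] (h : ℕ → A) (F : NFact σ) : Prop :=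
  Structure.RelMap F.2.1 (h ∘ F.2.2)

theorem NFact.holds_map {A : Type*} [σ.Structure A] (h : ℕ → A) (g : ℕ → ℕ) (F : NFact σ) :
    (F.map g).Holds h ↔ F.Holds (h ∘ g) := Iff.rfl

/-- The word of a list of facts. -/
def toToks (L : List (NFact σ)) : List (Tok (Σ r, σ.Relations r)) :=
  L.flatMap fun F => .sym (some ⟨F.1, F.2.1⟩) :: (List.ofFn F.2.2).map Tok.num

@[simp] theorem toToks_nil : toToks ([] : List (NFact σ)) = [] := rfl

@[simp] theorem toToks_append (L L' : List (NFact σ)) :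
    toToks (L ++ L') = toToks L ++ toToks L' := List.flatMap_append

theorem toToks_shift (b : ℕ) (L : List (NFact σ)) :
    (toToks L).map (Tok.shift b) = toToks (L.map (NFact.map (b + ·))) := by
  simp only [toToks, List.map_flatMap, List.flatMap_map]
  congr 1
  funext F
  simp [Tok.shift, NFact.map, List.map_ofFn, comp_def]

theorem toToks_subst (e : ℕ × ℕ) (L : List (NFact σ)) :
    (toToks L).map (Tok.subst e) =
      toToks (L.map (NFact.map fun n => if n = e.1 then e.2 else n)) := by
  simp only [toToks, List.map_flatMap, List.flatMap_map]
  congr 1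
  funext F
  simp [Tok.subst, NFact.map, List.map_ofFn, comp_def]

theorem sym_none_not_mem_toToks (L : List (NFact σ)) : Tok.sym none ∉ toToks L := by
  simp [toToks]

theorem num_mem_toToks (L : List (NFact σ)) (n : ℕ) :
    Tok.num n ∈ toToks L ↔ ∃ F ∈ L, ∃ i, F.2.2 i = n := by
  simp [toToks]

/-- Elimination of equations from a list of facts. -/
def elimFacts : List (ℕ × ℕ) → List (NFact σ) → List (NFact σ)
  | [], L => L
  | e :: E, L => elimFacts (E.map (substEq e))
      (L.map (NFact.map fun n => if n = e.1 then e.2 else n))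
termination_by E => E.length

theorem elimFacts_induction {motive : List (ℕ × ℕ) → List (NFact σ) → Prop}
    (nil : ∀ L, motive [] L)
    (cons : ∀ e E L, motive (E.map (substEq e))
      (L.map (NFact.map fun n => if n = e.1 then e.2 else n)) → motive (e :: E) L)
    (E : List (ℕ × ℕ)) (L : List (NFact σ)) : motive E L := by
  obtain ⟨k, hk⟩ : ∃ k, k = E.length := ⟨_, rfl⟩
  induction k generalizing E L with
  | zero => rw [List.length_eq_zero_iff.1 hk.symm]; exact nil L
  | succ k ih =>
    cases E with
    | nil => simp at hk
    | cons e E => exact cons e E L (ih _ _ (by simpa using hk))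

/-- Links the word manipulation of the program with the elimination on facts, about which
homomorphisms can be discussed. -/
theorem toToks_elimFacts (E : List (ℕ × ℕ)) (L : List (NFact σ)) :
    toToks (elimFacts E L) = elimToks E (toToks L) := by
  induction E, L using elimFacts_induction with
  | nil L => simp [elimFacts, elimToks]
  | cons e E L ih => rw [elimFacts, elimToks, ih, toToks_subst]

/-- `h` satisfies the equations `E` and the facts `L`. -/
def Sat {A : Type*} [σ.Structure A] (h : ℕ → A) (E : List (ℕ × ℕ)) (L : List (NFact σ)) : Prop :=
  (∀ e ∈ E, h e.1 = h e.2) ∧ ∀ F ∈ L, F.Holds h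

/-- Evaluating substituted facts by `h` is evaluating the original ones by `h` composed with the
substitution. That composite always solves the eliminated equation, and it equals `h` if `h` already
solves it. -/
theorem exists_sat_elimFacts {A : Type*} [σ.Structure A] (E : List (ℕ × ℕ)) (L : List (NFact σ)) :
    (∃ h : ℕ → A, Sat h [] (elimFacts E L)) ↔ ∃ h : ℕ → A, Sat h E L := by
  induction E, L using elimFacts_induction with
  | nil L => simp [elimFacts]
  | cons e E L ih =>
    rw [elimFacts, ih]
    have key : ∀ h : ℕ → A, Sat h (E.map (substEq e))
        (L.map (NFact.map fun n => if n = e.1 then e.2 else n)) ↔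
        Sat (fun n => h (if n = e.1 then e.2 else n)) E L := by
      intro h
      simp only [Sat, List.forall_mem_map]
      exact Iff.rfl
    simp only [key]
    constructor
    · rintro ⟨h, hE, hL⟩
      refine ⟨fun n => h (if n = e.1 then e.2 else n), List.forall_mem_cons.2 ⟨?_, hE⟩, hL⟩
      by_cases he : e.2 = e.1 <;> simp [he]
    · rintro ⟨h, hE, hL⟩
      rw [List.forall_mem_cons] at hE
      have : (fun n => h (if n = e.1 then e.2 else n)) = h := by
        funext n
        split_ifs with hn
        · rw [hn, hE.1]
        · rfl
      exact ⟨h, by rw [this]; exact ⟨hE.2, hL⟩⟩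

/-! ### Finite structures as lists of numbered facts -/

section Enumerate

variable [Finite (Σ r : ℕ, σ.Relations r)] (X : Type*) [Finite X] [σ.Structure X]

theorem exists_factList : ∃ L : List (Σ r : ℕ, σ.Relations r × (Fin r → X)),
    ∀ F, F ∈ L ↔ Structure.RelMap F.2.1 F.2.2 := by
  have : Finite (Σ r : ℕ, σ.Relations r × (Fin r → X)) :=
    Finite.of_injective (β := Σ R : (Σ r : ℕ, σ.Relations r), (Fin R.1 → X))
      (fun F => ⟨⟨F.1, F.2.1⟩, F.2.2⟩) (by
        rintro ⟨r, R, x⟩ ⟨r', R', x'⟩ h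
        simp only [Sigma.mk.injEq] at h
        obtain ⟨⟨rfl, h⟩, h'⟩ := h
        cases h; cases h'; rfl)
  exact ⟨(Set.toFinite {F : Σ r : ℕ, σ.Relations r × (Fin r → X) |
    Structure.RelMap F.2.1 F.2.2}).toFinset.toList, by simp⟩

/-- The facts of a finite structure, its elements numbered. -/
noncomputable def factsOf : List (NFact σ) :=
  (exists_factList (σ := σ) X).choose.map fun F =>
    ⟨F.1, F.2.1, fun i => (Finite.equivFin X (F.2.2 i) : ℕ)⟩

variable {X}

theorem factsOf_lt {F : NFact σ} (hF : F ∈ factsOf X) (i : Fin F.1) : F.2.2 i < Nat.card X := by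
  obtain ⟨F, -, rfl⟩ := List.mem_map.1 hF
  exact Fin.is_lt _

theorem holds_factsOf_iff {A : Type*} [σ.Structure A] (g : ℕ → A) :
    (∀ F ∈ factsOf (σ := σ) X, F.Holds g) ↔
      ∀ {r : ℕ} (R : σ.Relations r) (x : Fin r → X), Structure.RelMap R x →
        Structure.RelMap R fun i => g (Finite.equivFin X (x i)) := by
  have := (exists_factList (σ := σ) X).choose_spec
  simp only [factsOf, List.forall_mem_map, this]
  exact ⟨fun h r R x hx => h ⟨r, R, x⟩ hx, fun h F hF => h _ _ hF⟩

end Enumerate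

end RelCSP

namespace RelCSP

open Function FirstOrder Language

variable {σ τ : FirstOrder.Language.{0, 0}}

section Homs

variable [Finite (Σ r : ℕ, σ.Relations r)] {X : Type*} [Finite X] [σ.Structure X]
  {A : Type*} [σ.Structure A]

theorem holds_factsOf_of_hom (f : X →[σ] A) {g : ℕ → A}
    (hg : ∀ x, g (Finite.equivFin X x) = f x) : ∀ F ∈ factsOf (σ := σ) X, F.Holds g := by
  rw [holds_factsOf_iff]
  intro r R x hx
  simp only [hg]
  exact f.map_rel R x hx

theorem exists_hom_of_holds [σ.IsRelational] {g : ℕ → A} (h : ∀ F ∈ factsOf (σ := σ) X, F.Holds g) :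
    ∃ f : X →[σ] A, ∀ x, f x = g (Finite.equivFin X x) :=
  ⟨⟨fun x => g (Finite.equivFin X x), fun f _ => isEmptyElim f,
    fun R x hx => (holds_factsOf_iff g).1 h R x hx⟩, fun _ => rfl⟩

end Homs

/-! ### The glued structure of a pattern and the adjunction -/

namespace Pattern

variable [Finite (Σ r : ℕ, σ.Relations r)] (Ψ : Pattern.{v} σ τ)

open Classical in
/-- The combinatorial data of a pattern. -/
noncomputable def gadget : Gadget τ (Σ r, σ.Relations r) where
  nP := Nat.card Ψ.P
  outP := toToks (factsOf Ψ.P)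
  nQ R := Nat.card (Ψ.Q R.2)
  outQ R := toToks (factsOf (Ψ.Q R.2))
  q R i p := if h : p < Nat.card Ψ.P then
    Finite.equivFin (Ψ.Q R.2) (Ψ.q R.2 i ((Finite.equivFin Ψ.P).symm ⟨p, h⟩)) else 0
  outP_lt n hn := by
    obtain ⟨F, hF, i, rfl⟩ := (num_mem_toToks _ _).1 hn
    exact factsOf_lt hF i
  outQ_lt R n hn := by
    obtain ⟨F, hF, i, rfl⟩ := (num_mem_toToks _ _).1 hn
    exact factsOf_lt hF i
  q_lt R i p hp := by simp [hp]

theorem gadget_q (R : Σ r, τ.Relations r) (i : Fin R.1) (p : Ψ.P) :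
    Ψ.gadget.q R i (Finite.equivFin Ψ.P p) = Finite.equivFin (Ψ.Q R.2) (Ψ.q R.2 i p) := by
  simp [gadget]

theorem noEq_gadget : Ψ.gadget.NoEq :=
  ⟨sym_none_not_mem_toToks _, fun _ => sym_none_not_mem_toToks _⟩

/-- The facts of the copies of `P`. -/
noncomputable def elemFacts (b : ℕ) : ℕ → List (NFact σ)
  | 0 => []
  | n + 1 => (factsOf Ψ.P).map (NFact.map (b + ·)) ++ elemFacts (b + Nat.card Ψ.P) n

theorem toToks_elemFacts (b n : ℕ) : toToks (Ψ.elemFacts b n) = Ψ.gadget.elemToks b n := by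
  induction n generalizing b with
  | zero => rfl
  | succ n ih => rw [elemFacts, toToks_append, ih, ← toToks_shift]; rfl

variable {n : ℕ}

/-- The facts of the copies of the structures `Q R`. -/
noncomputable def genFacts (b : ℕ) :
    List (Σ r : ℕ, τ.Relations r × (Fin r → Fin n)) → List (NFact σ)
  | [] => []
  | F :: l => (factsOf (Ψ.Q F.2.1)).map (NFact.map (b + ·)) ++
      genFacts (b + Nat.card (Ψ.Q F.2.1)) l

theorem toToks_genFacts (b : ℕ) (l : List (Σ r : ℕ, τ.Relations r × (Fin r → Fin n))) :
    toToks (Ψ.genFacts b l) = Ψ.gadget.genToks b l := by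
  induction l generalizing b with
  | nil => rfl
  | cons F l ih => rw [genFacts, toToks_append, ih, ← toToks_shift]; rfl

variable {A : Type u} [σ.Structure A]

theorem holds_elemFacts_iff (h : ℕ → A) (b k : ℕ) : (∀ F ∈ Ψ.elemFacts b k, F.Holds h) ↔
    ∀ j < k, ∀ F ∈ factsOf (σ := σ) Ψ.P, F.Holds fun p => h (b + j * Nat.card Ψ.P + p) := by
  induction k generalizing b with
  | zero => simp [elemFacts]
  | succ k ih =>
    simp only [elemFacts, List.forall_mem_append, List.forall_mem_map, ih, NFact.holds_map]
    constructor
    · rintro ⟨h₀, h₁⟩ (_ | j) hj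
      · simpa [comp_def] using h₀
      · have := h₁ j (by omega)
        simpa [add_mul, add_assoc, add_comm (Nat.card Ψ.P)] using this
    · intro H
      refine ⟨by simpa [comp_def] using H 0 (by omega), fun j hj => ?_⟩
      have := H (j + 1) (by omega)
      simpa [add_mul, add_assoc, add_comm (Nat.card Ψ.P)] using this


/-- An evaluation of the gadgets gives homomorphisms from the structures `Q R`. -/
theorem exists_hom_of_sat [σ.IsRelational] {h : ℕ → A} {f : Fin n → Ψ.P →[σ] A}
    (hf : ∀ (j : Fin n) p, f j p = h (j * Nat.card Ψ.P + Finite.equivFin Ψ.P p)) (b : ℕ)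
    (l : List (Σ r : ℕ, τ.Relations r × (Fin r → Fin n)))
    (hs : Sat h (Ψ.gadget.genEqs b l) (Ψ.genFacts b l)) :
    ∀ F ∈ l, ∃ g : Ψ.Q F.2.1 →[σ] A, ∀ i, g.comp (Ψ.q F.2.1 i) = f (F.2.2 i) := by
  induction l generalizing b with
  | nil => simp
  | cons F l ih =>
    obtain ⟨hE, hL⟩ := hs
    rw [Gadget.genEqs, List.forall_mem_append] at hE
    rw [genFacts, List.forall_mem_append] at hL
    refine List.forall_mem_cons.2 ⟨?_, ih _ ⟨hE.2, hL.2⟩⟩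
    -- Restricting `h` to the block starting at `b` gives the witness `g`; the equations of this
    -- block say that `g` agrees with the copies of `P` along `q`.
    obtain ⟨g, hg⟩ := exists_hom_of_holds (g := h ∘ (b + ·))
      fun F' hF' => hL.1 _ (List.mem_map_of_mem hF')
    refine ⟨g, fun i => ?_⟩
    ext p
    have he := hE.1 (b + Ψ.gadget.q (Gadget.rel F) i (Finite.equivFin Ψ.P p),
      (F.2.2 i : ℕ) * Ψ.gadget.nP + (Finite.equivFin Ψ.P p : ℕ))
      (List.mem_flatMap.2 ⟨i, List.mem_finRange i, List.mem_map.2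
        ⟨Finite.equivFin Ψ.P p, List.mem_range.2 (Fin.is_lt _), rfl⟩⟩)
    rw [Hom.comp_apply, hg, hf]
    exact (congrArg (fun k => h (b + k)) (Ψ.gadget_q (Gadget.rel F) i p)).symm.trans he

/-- Homomorphisms from the structures `Q R` give an evaluation of the gadgets. -/
theorem exists_sat_of_hom (f : Fin n → Ψ.P →[σ] A) (b : ℕ) (hb : n * Nat.card Ψ.P ≤ b)
    (l : List (Σ r : ℕ, τ.Relations r × (Fin r → Fin n))) (h₀ : ℕ → A)
    (hf : ∀ (j : Fin n) p, h₀ ((j : ℕ) * Nat.card Ψ.P + Finite.equivFin Ψ.P p) = f j p)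
    (hl : ∀ F ∈ l, ∃ g : Ψ.Q F.2.1 →[σ] A, ∀ i, g.comp (Ψ.q F.2.1 i) = f (F.2.2 i)) :
    ∃ h : ℕ → A, (∀ k < b, h k = h₀ k) ∧ Sat h (Ψ.gadget.genEqs b l) (Ψ.genFacts b l) := by
  have hlt : ∀ (j : Fin n) (p : Ψ.P),
      (j : ℕ) * Nat.card Ψ.P + Finite.equivFin Ψ.P p < n * Nat.card Ψ.P := fun j p => by
    have h₁ := Nat.mul_le_mul_right (Nat.card Ψ.P) j.2
    rw [Nat.succ_mul (j : ℕ)] at h₁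
    have := (Finite.equivFin Ψ.P p).2
    omega
  induction l generalizing b h₀ with
  | nil => exact ⟨h₀, fun _ _ => rfl, by simp [Sat, Gadget.genEqs, genFacts]⟩
  | cons F l ih =>
    rw [List.forall_mem_cons] at hl
    obtain ⟨⟨g, hg⟩, hl⟩ := hl
    -- Overwrite the block of the new gadget by `g`. The copies of `P` lie below `b` and later
    -- gadgets above the block, so neither interferes.
    let h₁ : ℕ → A := fun k => if hk : b ≤ k ∧ k - b < Nat.card (Ψ.Q F.2.1) then
      g ((Finite.equivFin (Ψ.Q F.2.1)).symm ⟨k - b, hk.2⟩) else h₀ k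
    have h₁_lt : ∀ k < b, h₁ k = h₀ k := fun k hk => dif_neg fun h => by omega
    have h₁_add : ∀ x, h₁ (b + Finite.equivFin (Ψ.Q F.2.1) x) = g x := fun x => by
      have : b ≤ b + (Finite.equivFin (Ψ.Q F.2.1) x : ℕ) ∧
          b + (Finite.equivFin (Ψ.Q F.2.1) x : ℕ) - b < Nat.card (Ψ.Q F.2.1) :=
        ⟨by omega, by rw [Nat.add_sub_cancel_left]; exact Fin.is_lt _⟩
      simp [h₁]
    obtain ⟨h, hh, hE, hL⟩ := ih (b + Nat.card (Ψ.Q F.2.1)) (by omega) h₁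
      (fun j p => by rw [h₁_lt _ ((hlt j p).trans_le hb), hf]) hl
    have h_add : ∀ x, h (b + Finite.equivFin (Ψ.Q F.2.1) x) = g x := fun x => by
      rw [hh _ (by have := (Finite.equivFin (Ψ.Q F.2.1) x).2; omega), h₁_add]
    refine ⟨h, fun k hk => by rw [hh k (by omega), h₁_lt k hk], ?_, ?_⟩
    · rw [Gadget.genEqs, List.forall_mem_append]
      refine ⟨fun e he => ?_, hE⟩
      obtain ⟨i, -, he⟩ := List.mem_flatMap.1 he
      obtain ⟨p, hp, rfl⟩ := List.mem_map.1 he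
      rw [List.mem_range] at hp
      obtain ⟨x, rfl⟩ : ∃ x, p = (Finite.equivFin Ψ.P x : ℕ) :=
        ⟨(Finite.equivFin Ψ.P).symm ⟨p, hp⟩, by simp⟩
      have hx := hlt (F.2.2 i) x
      simp only [gadget_q]
      refine (h_add _).trans ?_
      refine Eq.trans ?_ (hh _ (by simp only [gadget]; omega)).symm
      refine Eq.trans ?_ (h₁_lt _ (by simp only [gadget]; omega)).symm
      refine Eq.trans ?_ (hf _ _).symm
      exact DFunLike.congr_fun (hg i) x
    · rw [genFacts, List.forall_mem_append]
      exact ⟨List.forall_mem_map.2 (holds_factsOf_of_hom g (g := h ∘ (b + ·)) h_add), hL⟩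

/-- The elements and facts of the glued structure, before gluing. -/
noncomputable def glueFacts (B : Input τ) : List (NFact σ) :=
  Ψ.elemFacts 0 B.size ++ Ψ.genFacts (B.size * Nat.card Ψ.P) B.facts

theorem toToks_glueFacts (B : Input τ) : toToks (Ψ.glueFacts B) = Ψ.gadget.toks B := by
  rw [glueFacts, toToks_append, toToks_elemFacts, toToks_genFacts]; rfl

/-- The adjunction. The values on the copy of `P` at `j` form a homomorphism `P → A`, the image of
`j` in `Ψ A`; the values on a copy of `Q R` form the witness that the listed tuple is in the
relation, and the equations say that the witness restricts correctly. -/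
theorem exists_sat_iff [σ.IsRelational] [τ.IsRelational] [Nonempty A] (B : Input τ) :
    (∃ h : ℕ → A, Sat h (Ψ.gadget.eqs B) (Ψ.glueFacts B)) ↔
      Nonempty (B.Universe →[τ] Ψ.Psi A) := by
  constructor
  · rintro ⟨h, hE, hL⟩
    rw [glueFacts, List.forall_mem_append, holds_elemFacts_iff] at hL
    have hP (j : Fin B.size) := exists_hom_of_holds (hL.1 j j.2)
    choose f hf using hP
    have hQ := Ψ.exists_hom_of_sat (f := f) (fun j p => by rw [hf, zero_add]) _ B.facts ⟨hE, hL.2⟩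
    exact ⟨⟨f, fun f _ => isEmptyElim f, fun R x hx => hQ _ hx⟩⟩
  · rintro ⟨φ⟩
    let f : Fin B.size → Ψ.P →[σ] A := φ
    -- Division with remainder recovers the element of `B` and the element of `P`. Numbers beyond
    -- the copies of `P` get an arbitrary value, and those in gadget blocks are overwritten
    -- afterwards.
    let h₀ : ℕ → A := fun k =>
      if hk : k / Nat.card Ψ.P < B.size ∧ k % Nat.card Ψ.P < Nat.card Ψ.P then
        f ⟨k / Nat.card Ψ.P, hk.1⟩ ((Finite.equivFin Ψ.P).symm ⟨k % Nat.card Ψ.P, hk.2⟩)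
      else Classical.arbitrary A
    have hf : ∀ (j : Fin B.size) p, h₀ ((j : ℕ) * Nat.card Ψ.P + Finite.equivFin Ψ.P p) = f j p := fun j p => by
      have h₁ : ((j : ℕ) * Nat.card Ψ.P + Finite.equivFin Ψ.P p) / Nat.card Ψ.P = j := by
        rw [mul_comm, Nat.mul_add_div Nat.card_pos, Nat.div_eq_of_lt (Fin.is_lt _), add_zero]
      have h₂ : ((j : ℕ) * Nat.card Ψ.P + Finite.equivFin Ψ.P p) % Nat.card Ψ.P =
          Finite.equivFin Ψ.P p := by
        exact Nat.mul_add_mod_of_lt (Fin.is_lt _)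
      simp [h₀, h₁, h₂]
    obtain ⟨h, hh, hs⟩ := Ψ.exists_sat_of_hom f (B.size * Nat.card Ψ.P) le_rfl B.facts h₀ hf
      fun F hF => φ.map_rel F.2.1 F.2.2 hF
    refine ⟨h, hs.1, ?_⟩
    rw [glueFacts, List.forall_mem_append, holds_elemFacts_iff]
    refine ⟨fun j hj => holds_factsOf_of_hom (f ⟨j, hj⟩) fun p => ?_, hs.2⟩
    rw [zero_add, hh, ← hf ⟨j, hj⟩ p]
    have h₁ := Nat.mul_le_mul_right (Nat.card Ψ.P) hj
    rw [Nat.succ_mul j] at h₁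
    have := (Finite.equivFin Ψ.P p).2
    omega

end Pattern

end RelCSP

/-! ### The polynomial-time reduction -/

namespace RelCSP

open Function FirstOrder Language StackProg

variable {σ τ : FirstOrder.Language.{0, 0}}

/-- The input with universe `{0, …, N - 1}` and a given list of facts. -/
def inputOf (N : ℕ) (hN : 0 < N) (L : List (NFact σ)) : Input σ where
  size := N
  size_pos := hN
  facts := L.map fun F => ⟨F.1, F.2.1, fun i => ⟨F.2.2 i % N, Nat.mod_lt _ hN⟩⟩

/-- Under `hL` the reduction modulo `N` in `inputOf` changes no entry; it only makes the definition
total. Likewise the values of an evaluation from `N` on are irrelevant. -/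
theorem csp_inputOf [σ.IsRelational] {A : Type u} [σ.Structure A] [Nonempty A] (N : ℕ) (hN : 0 < N)
    (L : List (NFact σ)) (hL : ∀ F ∈ L, ∀ i, F.2.2 i < N) :
    Nonempty ((inputOf N hN L).Universe →[σ] A) ↔ ∃ h : ℕ → A, Sat h [] L := by
  constructor
  · rintro ⟨φ⟩
    let f : Fin N → A := φ
    refine ⟨fun k => f ⟨k % N, Nat.mod_lt _ hN⟩, by simp, fun F hF => ?_⟩
    exact φ.map_rel F.2.1 (fun i => (⟨F.2.2 i % N, Nat.mod_lt _ hN⟩ : Fin N))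
      (List.mem_map.2 ⟨F, hF, rfl⟩)
  · rintro ⟨h, -, hs⟩
    refine ⟨⟨fun x => h (Fin.val (n := N) x), fun f _ => isEmptyElim f, fun {r} R x hx => ?_⟩⟩
    obtain ⟨⟨r', R', y⟩, hF, he⟩ := List.mem_map.1 hx
    cases he
    have := hs _ hF
    simp only [NFact.Holds] at this
    convert this using 2
    funext i
    exact congrArg h (Nat.mod_eq_of_lt (hL _ hF i))

/-- The letters of the words of inputs. -/
def convLetter : WLetter (Σ r, σ.Relations r) → Letter σ
  | .sym (some R) => .rel R.2
  | .sym none => .tick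
  | .tick => .tick
  | .mark => .mark

theorem map_convLetter_encTok_num (n : ℕ) :
    (encTok (.num n)).map (convLetter (σ := σ)) = encodeNat σ n := by
  simp [encTok, encodeNat, convLetter]

/-- The working alphabet spells inputs up to renaming of letters. `toToks` contains no equation
marker, so the value of `convLetter` at `.sym none` plays no role. -/
theorem encode_inputOf (N : ℕ) (hN : 0 < N) (L : List (NFact σ))
    (hL : ∀ F ∈ L, ∀ i, F.2.2 i < N) :
    (inputOf N hN L).encode = (List.replicate N WLetter.tick ++
      WLetter.mark :: enc (toToks L)).map convLetter := by
  have h₁ : (List.replicate N WLetter.tick ++ WLetter.mark :: enc (toToks L)) =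
      encTok (.num N) ++ enc (toToks L) := by simp [encTok]
  rw [h₁, List.map_append, map_convLetter_encTok_num]
  refine congrArg (encodeNat σ N ++ ·) ?_
  simp only [inputOf]
  clear h₁
  induction L with
  | nil => rfl
  | cons F L ih =>
    rw [List.forall_mem_cons] at hL
    rw [List.map_cons, List.flatMap_cons, ih hL.2]
    change _ = ((enc (toToks ([F] ++ L))).map convLetter)
    rw [toToks_append, enc_append, List.map_append]
    congr 1
    simp only [toToks, List.flatMap_cons, List.flatMap_nil, List.append_nil, enc_cons,
      List.map_append]
    refine congrArg (Letter.rel F.2.1 :: ·) ?_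
    simp only [enc, List.flatMap_map, List.map_flatMap, List.ofFn_eq_map]
    congr 1
    funext i
    rw [map_convLetter_encTok_num, Nat.mod_eq_of_lt (hL.1 i)]

instance finite_letter [Finite (Σ r : ℕ, τ.Relations r)] : Finite (Letter τ) :=
  Finite.of_surjective
    (fun o : (Σ r : ℕ, τ.Relations r) ⊕ Bool =>
      o.elim (fun R => Letter.rel R.2) fun b => bif b then Letter.tick else Letter.mark)
    fun a => match a with
      | .rel R => ⟨.inl ⟨_, R⟩, rfl⟩
      | .tick => ⟨.inr true, rfl⟩
      | .mark => ⟨.inr false, rfl⟩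

instance finite_wLetter {ρ : Type} [Finite ρ] : Finite (WLetter ρ) :=
  Finite.of_surjective
    (fun o : Option ρ ⊕ Bool =>
      o.elim WLetter.sym fun b => bif b then WLetter.tick else WLetter.mark)
    fun a => match a with
      | .sym a => ⟨.inl a, rfl⟩
      | .tick => ⟨.inr true, rfl⟩
      | .mark => ⟨.inr false, rfl⟩

instance finite_stkΓ {ι ρ : Type} [Finite ι] [Finite ρ] : ∀ k, Finite (StkΓ ι ρ k)
  | .inp => inferInstanceAs (Finite ι)
  | .cnt _ => inferInstanceAs (Finite Unit)
  | .wrd _ => inferInstanceAs (Finite (WLetter ρ))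

theorem size_le_length_encode (B : Input τ) : B.size ≤ B.encode.length := by
  simp [Input.encode, encodeNat]

theorem length_facts_le_length_encode (B : Input τ) : B.facts.length ≤ B.encode.length := by
  rw [Input.encode, List.length_append]
  refine le_trans ?_ (Nat.le_add_left _ _)
  generalize B.facts = l
  induction l with
  | nil => simp
  | cons F l ih => simp; omega

/-! ### Polynomial bounds for the size of the glued structure -/

namespace Gadget

variable {ρ : Type} (G : Gadget τ ρ) {n D : ℕ}

theorem total_le (hD : ∀ R, G.nQ R ≤ D) (b : ℕ)
    (l : List (Σ r : ℕ, τ.Relations r × (Fin r → Fin n))) :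
    G.total b l ≤ b + l.length * D := by
  induction l generalizing b with
  | nil => simp [total]
  | cons F l ih =>
    have := ih (b + G.nQ (rel F))
    have := hD (rel F)
    rw [total, List.length_cons, Nat.succ_mul]
    omega

theorem length_elemToks (b k : ℕ) : (G.elemToks b k).length = k * G.outP.length := by
  induction k generalizing b with
  | zero => simp [elemToks]
  | succ k ih => simp [elemToks, ih, Nat.succ_mul, add_comm]

theorem length_genToks_le (hD : ∀ R, (G.outQ R).length ≤ D) (b : ℕ)
    (l : List (Σ r : ℕ, τ.Relations r × (Fin r → Fin n))) :
    (G.genToks b l).length ≤ l.length * D := by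
  induction l generalizing b with
  | nil => simp [genToks]
  | cons F l ih =>
    have := ih (b + G.nQ (rel F))
    have := hD (rel F)
    rw [genToks, List.length_append, List.length_map, List.length_cons, Nat.succ_mul]
    omega

theorem length_genEqs_le (hD : ∀ R : Σ r, τ.Relations r, R.1 ≤ D) (b : ℕ)
    (l : List (Σ r : ℕ, τ.Relations r × (Fin r → Fin n))) :
    (G.genEqs b l).length ≤ l.length * (D * G.nP) := by
  induction l generalizing b with
  | nil => simp [genEqs]
  | cons F l ih =>
    have := ih (b + G.nQ (rel F))
    have := Nat.mul_le_mul_right G.nP (hD (rel F))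
    have h : (G.eqFact b F).length = (rel F).1 * G.nP := by
      simp [eqFact, eqArg, List.length_flatMap, rel]
    rw [genEqs, List.length_append, List.length_cons, Nat.succ_mul, h]
    omega

/-- The program `translate` runs in polynomial time. -/
theorem exists_polynomial_runs [Finite (Σ r : ℕ, τ.Relations r)] (hG : G.NoEq) :
    ∃ q : Polynomial ℕ, ∀ B : Input τ,
      Runs G.translate (single Stk.inp B.encode) (single (Γ := StkΓ (Letter τ) ρ) (Stk.wrd .rev)
        (List.replicate (G.card B) WLetter.tick ++
          WLetter.mark :: enc (elimToks (G.eqs B) (G.toks B))).reverse)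
        (q.eval B.encode.length) := by
  obtain ⟨D, hD⟩ := (Set.finite_range fun R : (Σ r : ℕ, τ.Relations r) =>
    R.1 + (G.outQ R).length + G.nQ R).bddAbove
  have hD : ∀ R : (Σ r : ℕ, τ.Relations r), R.1 + (G.outQ R).length + G.nQ R ≤ D :=
    fun R => hD ⟨R, rfl⟩
  have hD₁ : ∀ R : (Σ r : ℕ, τ.Relations r), R.1 ≤ D := fun R => by have := hD R; omega
  have hD₂ : ∀ R, (G.outQ R).length ≤ D := fun R => by have := hD R; omega
  have hD₃ : ∀ R, G.nQ R ≤ D := fun R => by have := hD R; omega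
  -- For input length `x`, the elements contribute at most `x * nP` numbers and the facts at most `x
  -- * D`; the extra one makes `x * k` also bound the size of the universe when `nP` and `D` vanish.
  let k := G.nP + D + 1
  -- Each fact yields at most `D * nP` equations of three tokens and `D` tokens from its gadget;
  -- each element yields the tokens of one copy of `P`.
  let m := 3 * (D * G.nP) + G.outP.length + D
  have hq : ∃ q : Polynomial ℕ, ∀ x, q.eval x =
      G.translateTime D x x (x * (D * G.nP)) (x * m) (x * k) := by
    let X : Polynomial ℕ := Polynomial.X
    let C : ℕ → Polynomial ℕ := fun c => Polynomial.C c
    let K := X * C k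
    let M := X * C m
    refine ⟨X * (C G.outP.length * (7 * K + 5) + C G.nP + 4) +
      X * ((C D * (K * (C G.nP + 3) + 3 * C G.nP * (7 * K + 5) + 2 * K + 4) +
        C D * (7 * K + 5) + C D + 3) + 3) +
      X * (C D * C G.nP) * (M * (20 * K + 22) + 4 * (M * (K + 1)) + 10 * K + 20) +
      12 * (M * (K + 1)) + 13 * K + 30, fun x => ?_⟩
    simp [X, C, K, M, translateTime, relTime, argTime, elimTime]
    ring
  obtain ⟨q, hq⟩ := hq
  refine ⟨q, fun B => ?_⟩
  have hn := size_le_length_encode B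
  have hf := length_facts_le_length_encode B
  obtain ⟨x, hx⟩ : ∃ x, x = B.encode.length := ⟨_, rfl⟩
  rw [← hx] at hn hf ⊢
  have hE : (G.eqs B).length ≤ x * (D * G.nP) :=
    (G.length_genEqs_le hD₁ _ _).trans (Nat.mul_le_mul_right _ hf)
  have hK : G.card B ≤ x * k := by
    refine (G.total_le hD₃ _ _).trans ?_
    have h₁ := Nat.mul_le_mul_right G.nP hn
    have h₂ := Nat.mul_le_mul_right D hf
    simp only [k, mul_add]
    omega
  have hK' : B.size ≤ x * k := hn.trans (Nat.le_mul_of_pos_right _ (by simp [k]))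
  have hm : (eqToks (G.eqs B) ++ G.toks B).length ≤ x * m := by
    have h₁ := Nat.mul_le_mul_right G.outP.length hn
    have h₂ := (G.length_genToks_le hD₂ (B.size * G.nP) B.facts).trans
      (Nat.mul_le_mul_right _ hf)
    rw [List.length_append, length_eqToks, toks, List.length_append, length_elemToks]
    simp only [m, mul_add]
    rw [mul_left_comm x 3]
    omega
  refine (G.go_translate hG B D (x * m) (x * k) hD₁ hD₂ hD₃ hm hK hK').mono ?_
  rw [hq]
  -- The time bound is monotone in each parameter, so the actual sizes may be replaced by their
  -- bounds in `x`.
  unfold translateTime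
  gcongr

end Gadget

theorem polynomialCSP_psi [σ.IsRelational] [τ.IsRelational] [Finite (Σ r : ℕ, σ.Relations r)]
    [Finite (Σ r : ℕ, τ.Relations r)] (Ψ : Pattern.{v} σ τ) (A : Type u) [σ.Structure A]
    [Nonempty A] (hA : PolynomialCSP σ A) : PolynomialCSP τ (Ψ.Psi A) := by
  obtain ⟨M⟩ := hA
  have hcard (B : Input τ) : 0 < Ψ.gadget.card B :=
    (Nat.mul_pos B.size_pos Nat.card_pos).trans_le (Ψ.gadget.le_total _ B.facts)
  let L (B : Input τ) := elimFacts (Ψ.gadget.eqs B) (Ψ.glueFacts B)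
  have hL (B : Input τ) : ∀ F ∈ L B, ∀ i, F.2.2 i < Ψ.gadget.card B := fun F hF i => by
    have h : Tok.num (F.2.2 i) ∈ toToks (L B) := (num_mem_toToks _ _).2 ⟨F, hF, i, rfl⟩
    rw [toToks_elimFacts, Ψ.toToks_glueFacts] at h
    -- `elimToks_le` preserves non-strict bounds, so the strict bound by the cardinality is applied
    -- with its predecessor.
    have := elimToks_le _ _ (K := Ψ.gadget.card B - 1)
      (fun x hx => Nat.le_pred_of_lt (Ψ.gadget.mem_lt_card B x hx)) _ h
    have := hcard B
    omega
  let f (B : Input τ) : Input σ := inputOf (Ψ.gadget.card B) (hcard B) (L B)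
  -- The reduction: passing through the existence of an evaluation, elimination and the adjunction
  -- combine to equal answers on `B` and on its glued input.
  have hf : csp (Ψ.Psi A) = csp A ∘ f := by
    funext B
    refine decide_eq_decide.2 ?_
    rw [csp_inputOf _ _ _ (hL B), exists_sat_elimFacts, Ψ.exists_sat_iff]
  obtain ⟨q, hq⟩ := Ψ.gadget.exists_polynomial_runs Ψ.noEq_gadget
  rw [PolynomialCSP, hf]
  let _ : Inhabited (Letter σ) := ⟨.tick⟩
  refine computableInPolyTime_comp (Γ := StkΓ (Letter τ) (Σ r, σ.Relations r)) (kin := Stk.inp)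
    (kout := Stk.wrd .rev) (by simp) (Equiv.refl _) convLetter Ψ.gadget.translate q
    (fun B => ⟨_, ?_, by rw [Equiv.refl_symm, Equiv.coe_refl, List.map_id]; exact hq B⟩) M
  rw [List.map_reverse, List.reverse_reverse, encode_inputOf _ _ _ (hL B), toToks_elimFacts,
    Ψ.toToks_glueFacts]

end RelCSP

theorem corollary4p2 (σ τ : FirstOrder.Language.{0, 0}) [σ.IsRelational] [τ.IsRelational]
    [Finite (Σ r : ℕ, σ.Relations r)] [Finite (Σ r : ℕ, τ.Relations r)]
    (Ψ : RelCSP.Pattern.{v} σ τ) (A : Type u) [σ.Structure A] [Nonempty A]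
    (hA : RelCSP.PolynomialCSP σ A) :
    RelCSP.PolynomialCSP τ (Ψ.Psi A) :=
  RelCSP.polynomialCSP_psi Ψ A hA
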